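/- **Definitions.** Let $X:\Sigma\to\mathbb R^3$ be a smooth immersion of a connected smooth surface $\Sigma$. Let $\mathcal N$ be a (local) unit normal, $K$ the Gaussian curvature, $H$ the mean curvature with respect to $\mathcal N$ (half the sum of the principal curvatures, computed from the second fundamental form $\langle X_{,ij},\mathcal N\rangle$), $\psi=\langle X,\mathcal N\rangle$ the support function and $\Lambda=\langle X,X\rangle$. The surface is an *SS-surface* if at every point $K\neq 0$ and the sphere with centre $X+\left(\frac HK+\frac\psi2\right)\mathcal N$ and (signed) radius $\frac HK+\frac\psi2$ passes through the origin, i.e. $2\psi H+(\Lambda+\psi^2)K=0$. (This does not depend on the choice of $\mathcal N$.) The surface is said to be *locally parametrized by* a map $Y(u_1,u_2)$ near a point if there are smooth coordinates $(u_1,u_2)$ on a neighbourhood of that point in which $X=Y(u_1,u_2)$. It is a *surface of rotation* with axis a given line of $\mathbb R^3$ if, after an isometry of $\mathbb R^3$ carrying the $x_3$-axis to that line, near each of its points that does not lie on the axis it is locally parametrized by a map $(\rho(u_1)\cos u_2,\rho(u_1)\sin u_2,\zeta(u_1))$ with smooth $\rho,\zeta:\mathbb R\to\mathbb R$. (So open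 pieces of globally rotation-invariant surfaces are included, and points on the axis may occur as poles.) For $a,b\in\mathbb R$ put $$X_{a,b}(u_1,u_2)=\bigl(M(u_1)\cos u_2,\;M(u_1)\sin u_2,\;N(u_1)\bigr),$$ $$M(u_1)=e^{au_1+b}\left[\frac{a(1-e^{2u_1})}{2e^{u_1}}+\frac{2e^{u_1}}{1+e^{2u_1}}\right],\qquad N(u_1)=e^{au_1+b}\left[\frac{1-e^{2u_1}}{1+e^{2u_1}}-a\right].$$ **Theorem.** Let $\Sigma$ be a connected SS-surface. 1. $\Sigma$ is a surface of rotation (about some line of $\mathbb R^3$) if and only if there are an orthogonal transformation $A$ of $\mathbb R^3$ and constants $a,b\in\mathbb R$ such that, near each of its points not on the line $A(x_3\text{-axis})$, $\Sigma$ is locally parametrized by $A\circ X_{a,b}$. 2. $\Sigma$ is a surface of rotation about the $x_3$-axis if and only if there are constants $a,b\in\mathbb R$ such that, near each of its points not on the $x_3$-axis, $\Sigma$ is locally parametrized by $X_{a,b}$. 3. For holomorphic $f,g$ with $g'\ne0$ and $T=1+|g|^2$ consider the Weierstrass type representation (with $\mathbb R^3=\mathbb C\times\mathbb R$, $\langle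 v,w\rangle=\operatorname{Re}(\bar v w)$ on $\mathbb C$) $$X=\frac{e^{\operatorname{Re} f}}{2|g'|^2}\Bigl(T g'\overline{f'}-2g\langle g',gf'\rangle,\;-2\langle g',gf'\rangle\Bigr)+e^{\operatorname{Re} f}\,\frac{(2g,\,2-T)}{T},$$ with unit normal $\frac{(2g,2-T)}{T}$. For $a\in\mathbb R$, $z_0\in\mathbb C$ and $b=\operatorname{Re}z_0$, the map $X_{a,b}(u_1,u_2)$ is exactly this representation at $z=u_1+iu_2$ for $f(z)=az+z_0$, $g(z)=e^z$, and $\frac{(2g,2-T)}{T}$ is orthogonal to the derivative of $X_{a,b}$. -/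

import Mathlib

open scoped Manifold ContDiff

noncomputable section

namespace SSSurface

/-- The parameter plane. -/
abbrev E2 : Type := EuclideanSpace ℝ (Fin 2)

/-- Euclidean three-space. -/
abbrev E3 : Type := EuclideanSpace ℝ (Fin 3)

/-! ### Local differential geometry of a parametrization `Y : E2 → E3` -/

/-- Partial derivative of `Y` in the `i`-th coordinate direction. -/
def partialD (i : Fin 2) (Y : E2 → E3) (u : E2) : E3 :=
  fderiv ℝ Y u (EuclideanSpace.single i 1)

/-- Cross product in Euclidean three-space. -/
def cross (v w : E3) : E3 :=
  WithLp.toLp 2 (crossProduct (WithLp.ofLp v) (WithLp.ofLp w))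

/-- Unit normal `N = Y₁ × Y₂ / |Y₁ × Y₂|` of the parametrization. -/
def unitNormal (Y : E2 → E3) (u : E2) : E3 :=
  ‖cross (partialD 0 Y u) (partialD 1 Y u)‖⁻¹ • cross (partialD 0 Y u) (partialD 1 Y u)

/-- Coefficients of the first fundamental form. -/
def firstForm (Y : E2 → E3) (u : E2) (i j : Fin 2) : ℝ :=
  inner ℝ (partialD i Y u) (partialD j Y u)

/-- Coefficients of the second fundamental form, `⟨Y_{ij}, N⟩ = -⟨Y_i, N_j⟩`. -/
def secondForm (Y : E2 → E3) (u : E2) (i j : Fin 2) : ℝ :=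
  inner ℝ (partialD i (partialD j Y) u) (unitNormal Y u)

/-- Determinant of the first fundamental form. -/
def firstFormDet (Y : E2 → E3) (u : E2) : ℝ :=
  firstForm Y u 0 0 * firstForm Y u 1 1 - firstForm Y u 0 1 ^ 2

/-- Gaussian curvature `K`. -/
def gaussCurvature (Y : E2 → E3) (u : E2) : ℝ :=
  (secondForm Y u 0 0 * secondForm Y u 1 1 - secondForm Y u 0 1 ^ 2) / firstFormDet Y u

/-- Mean curvature `H` (half the sum of the principal curvatures, with respect to `N`). -/
def meanCurvature (Y : E2 → E3) (u : E2) : ℝ :=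
  (secondForm Y u 0 0 * firstForm Y u 1 1 - 2 * secondForm Y u 0 1 * firstForm Y u 0 1
    + secondForm Y u 1 1 * firstForm Y u 0 0) / (2 * firstFormDet Y u)

/-- Support function `ψ = ⟨Y, N⟩`. -/
def supportFunction (Y : E2 → E3) (u : E2) : ℝ :=
  inner ℝ (Y u) (unitNormal Y u)

/-- The signed radius `H / K + ψ / 2`. -/
def ssRadius (Y : E2 → E3) (u : E2) : ℝ :=
  meanCurvature Y u / gaussCurvature Y u + supportFunction Y u / 2

/-- At the parameter `u` the Gaussian curvature is non-zero and the sphere with centre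
`Y + (H / K + ψ / 2) N` and (signed) radius `H / K + ψ / 2` goes through the origin.
Reversing the orientation changes the sign of `H`, `ψ` and `N`, so that the condition does
not depend on the orientation. -/
def IsSSAt (Y : E2 → E3) (u : E2) : Prop :=
  gaussCurvature Y u ≠ 0 ∧
    (0 : E3) ∈ Metric.sphere (Y u + ssRadius Y u • unitNormal Y u) |ssRadius Y u|

/-! ### Immersed surfaces -/

section Surfaces

variable {M : Type*} [TopologicalSpace M] [ChartedSpace E2 M]

/-- `X : M → E3` is a smooth immersion. -/
def IsImmersedSurface (X : M → E3) : Prop :=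
  ContMDiff (𝓡 2) 𝓘(ℝ, E3) ∞ X ∧
    ∀ p : M, Function.Injective (mfderiv (𝓡 2) 𝓘(ℝ, E3) X p)

/-- An SS-surface: an immersed surface each of whose local parametrizations `X ∘ σ⁻¹`
(`σ` a smooth chart) satisfies the defining sphere condition at every point. -/
def IsSSSurface (X : M → E3) : Prop :=
  IsImmersedSurface X ∧
    ∀ σ ∈ IsManifold.maximalAtlas (𝓡 2) ∞ M, ∀ u ∈ σ.target,
      IsSSAt (fun v => X (σ.symm v)) u

/-- Near `p` the surface `X` is parametrized by `Y`: in suitable smooth coordinates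
`(u₁, u₂)` of the surface around `p` one has `X = Y(u₁, u₂)`. -/
def IsParametrizedNear (X : M → E3) (Y : E2 → E3) (p : M) : Prop :=
  ∃ σ ∈ IsManifold.maximalAtlas (𝓡 2) ∞ M,
    p ∈ σ.source ∧ ∀ q ∈ σ.source, X q = Y (σ q)

/-- The `x₃`-axis. -/
def x3Axis : Set E3 := {x | x 0 = 0 ∧ x 1 = 0}

/-- The map `(u₁, u₂) ↦ (ρ(u₁) cos u₂, ρ(u₁) sin u₂, ζ(u₁))`, which rotates the plane curve
`(ρ, ζ)` about the `x₃`-axis. -/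
def revolve (ρ ζ : ℝ → ℝ) (u : E2) : E3 :=
  !₂[ρ (u 0) * Real.cos (u 1), ρ (u 0) * Real.sin (u 1), ζ (u 0)]

/-- `X` is a surface of rotation whose axis is the image of the `x₃`-axis under the isometry
`Φ` of space: around each of its points off the axis it is generated by rotating a smooth curve
about the axis. (Being of rotation is a local condition, so open pieces count; points of the
axis can occur as poles.) -/
def IsSurfaceOfRotationAbout (Φ : E3 ≃ᵃⁱ[ℝ] E3) (X : M → E3) : Prop :=
  ∀ p : M, X p ∉ Φ '' x3Axis →
    ∃ ρ ζ : ℝ → ℝ, ContDiff ℝ ∞ ρ ∧ ContDiff ℝ ∞ ζ ∧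
      IsParametrizedNear X (fun u => Φ (revolve ρ ζ u)) p

/-- `X` is a surface of rotation about some line of space. -/
def IsSurfaceOfRotation (X : M → E3) : Prop :=
  ∃ Φ : E3 ≃ᵃⁱ[ℝ] E3, IsSurfaceOfRotationAbout Φ X

end Surfaces

/-! ### The explicit family -/

/-- The radial profile function `M`. -/
def profileM (a b t : ℝ) : ℝ :=
  Real.exp (a * t + b) *
    (a * (1 - Real.exp (2 * t)) / (2 * Real.exp t)
      + 2 * Real.exp t / (1 + Real.exp (2 * t)))

/-- The height profile function `N`. -/
def profileN (a b t : ℝ) : ℝ :=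
  Real.exp (a * t + b) * ((1 - Real.exp (2 * t)) / (1 + Real.exp (2 * t)) - a)

/-- `X_{a,b}(u₁, u₂) = (M(u₁) cos u₂, M(u₁) sin u₂, N(u₁))`. -/
def rotationalSS (a b : ℝ) : E2 → E3 :=
  revolve (profileM a b) (profileN a b)

/-! ### The Weierstrass type representation -/

/-- The identification of `ℂ × ℝ` with Euclidean three-space. -/
def ofComplexReal (w : ℂ) (t : ℝ) : E3 := !₂[w.re, w.im, t]

/-- `T = 1 + |g|²`. -/
def weierT (g : ℂ → ℂ) (z : ℂ) : ℝ := 1 + ‖g z‖ ^ 2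

/-- The Gauss map `(2 g, 2 - T) / T`. -/
def weierNormal (g : ℂ → ℂ) (z : ℂ) : E3 :=
  (weierT g z)⁻¹ • ofComplexReal (2 * g z) (2 - weierT g z)

/-- The representation
`e^{⟨1,f⟩} / (2 |g'|²) (T g' f'^* - 2 g ⟨g', g f'⟩, -2 ⟨g', g f'⟩) + e^{⟨1,f⟩} (2 g, 2 - T) / T`,
where `⟨v, w⟩ = Re (v^* w)` is the real inner product of `ℂ` and `^*` is conjugation. -/
def weierSurface (f g : ℂ → ℂ) (z : ℂ) : E3 :=
  (Real.exp (f z).re / (2 * ‖deriv g z‖ ^ 2)) •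
      ofComplexReal
        ((weierT g z : ℂ) * deriv g z * (starRingEnd ℂ) (deriv f z)
          - 2 * g z * ((inner ℝ (deriv g z) (g z * deriv f z) : ℝ) : ℂ))
        (-2 * inner ℝ (deriv g z) (g z * deriv f z))
    + Real.exp (f z).re • weierNormal g z

end SSSurface

end

/-!
An SS-surface has `K ≠ 0`, so it can be described by its support function `ψ` as a function of the
unit normal, and the SS-condition `2 ψ H + (Λ + ψ²) K = 0` says that `log |ψ|` is harmonic on the
sphere of normals. For a surface of rotation `ψ` depends only on the conformal height `τ` of the
normal `(cos θ / cosh τ, sin θ / cosh τ, -tanh τ)`, so that `ψ = e ^ (a τ + b)`, and the surface is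
recovered from `ψ` as the envelope of its tangent planes. The proof carries this out for the
generating curve `(ρ, ζ)`.

* `IsSSAt.of_normal` and `IsSSAt.revolve_eq` turn the sphere condition into a polynomial equation in
  the 2-jet of the curve. If the axis misses the origin, this equation has a non-zero quadratic
  term in the cosine of the angle, so the axis passes through the origin
  (`IsSSSurface.axis_through_origin`).
* Off the axis `ψ` cannot vanish, and `exists_profile` integrates the equation. Changing coordinates
  by `(t, θ) ↦ (τ(t), θ)` or `(τ(t), θ + π)` gives
  `exists_isParametrizedNear_rotationalSS`: locally the surface is `rotationalSS a b`.
* The constants are determined by the tangent plane and the position at a single point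
  (`eq_of_isParametrizedNear`), hence locally constant off the axis. At a point of the axis the
  normal is parallel to the axis, so such points are isolated (`eventually_notMem_axis`); as a
  punctured disc is connected, the constants agree around it, and by connectedness of the surface
  they agree everywhere (`exists_rotationalSS`).
-/

namespace SSSurface

open scoped Topology

/-! ### Normals and the sphere condition -/

lemma inner_eq_sum (v w : E3) : inner ℝ v w = v 0 * w 0 + v 1 * w 1 + v 2 * w 2 := by
  simp [PiLp.inner_apply, Fin.sum_univ_three, mul_comm]

lemma cross_zero (v w : E3) : cross v w 0 = v 1 * w 2 - v 2 * w 1 := by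
  simp [cross, crossProduct]

lemma cross_one (v w : E3) : cross v w 1 = v 2 * w 0 - v 0 * w 2 := by
  simp [cross, crossProduct]

lemma cross_two (v w : E3) : cross v w 2 = v 0 * w 1 - v 1 * w 0 := by
  simp [cross, crossProduct]

lemma ext_three {v w : E3} (h0 : v 0 = w 0) (h1 : v 1 = w 1) (h2 : v 2 = w 2) : v = w := by
  ext i
  fin_cases i <;> assumption

/-- Lagrange's identity. -/
lemma norm_cross_sq (v w : E3) :
    ‖cross v w‖ ^ 2 = inner ℝ v v * inner ℝ w w - inner ℝ v w ^ 2 := by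
  rw [← real_inner_self_eq_norm_sq]
  simp only [inner_eq_sum, cross_zero, cross_one, cross_two]
  ring

lemma inner_cross_left (v w : E3) : inner ℝ (cross v w) v = 0 := by
  simp only [inner_eq_sum, cross_zero, cross_one, cross_two]
  ring

lemma inner_cross_right (v w : E3) : inner ℝ (cross v w) w = 0 := by
  simp only [inner_eq_sum, cross_zero, cross_one, cross_two]
  ring

/-- A vector orthogonal to two independent vectors is a multiple of their cross product. -/
lemma exists_smul_cross {v w ν : E3} (h : cross v w ≠ 0) (hv : inner ℝ ν v = 0)
    (hw : inner ℝ ν w = 0) : ∃ k : ℝ, ν = k • cross v w := by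
  have h2 : ‖cross v w‖ ^ 2 ≠ 0 := by simpa using h
  have h3 : ‖cross v w‖ ^ 2 = cross v w 0 * cross v w 0 + cross v w 1 * cross v w 1
      + cross v w 2 * cross v w 2 := by
    rw [← real_inner_self_eq_norm_sq, inner_eq_sum]
  rw [inner_eq_sum] at hv hw
  refine ⟨inner ℝ ν (cross v w) / ‖cross v w‖ ^ 2, ?_⟩
  apply ext_three <;>
    (simp only [PiLp.smul_apply, smul_eq_mul]
     rw [div_mul_eq_mul_div, eq_div_iff h2, h3, inner_eq_sum]
     simp only [cross_zero, cross_one, cross_two])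
  · linear_combination -((v 2 * w 0 - v 0 * w 2) * w 2 - (v 0 * w 1 - v 1 * w 0) * w 1) * hv
      + ((v 2 * w 0 - v 0 * w 2) * v 2 - (v 0 * w 1 - v 1 * w 0) * v 1) * hw
  · linear_combination -((v 0 * w 1 - v 1 * w 0) * w 0 - (v 1 * w 2 - v 2 * w 1) * w 2) * hv
      + ((v 0 * w 1 - v 1 * w 0) * v 0 - (v 1 * w 2 - v 2 * w 1) * v 2) * hw
  · linear_combination -((v 1 * w 2 - v 2 * w 1) * w 1 - (v 2 * w 0 - v 0 * w 2) * w 0) * hv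
      + ((v 1 * w 2 - v 2 * w 1) * v 1 - (v 2 * w 0 - v 0 * w 2) * v 0) * hw

lemma IsSSAt.cross_ne_zero {Y : E2 → E3} {u : E2} (h : IsSSAt Y u) :
    cross (partialD 0 Y u) (partialD 1 Y u) ≠ 0 := by
  intro h0
  apply h.1
  have : firstFormDet Y u = 0 := by
    have := norm_cross_sq (partialD 0 Y u) (partialD 1 Y u)
    rw [h0] at this
    simpa [firstFormDet, firstForm] using this.symm
  simp [gaussCurvature, this]

/-- The sphere condition with respect to an arbitrary normal field `ν`, cleared of denominators:
for a unit normal it reads `2 ψ H + (Λ + ψ²) K = 0`, multiplied by the determinant of the first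
fundamental form. -/
lemma IsSSAt.of_normal {Y : E2 → E3} {u : E2} (h : IsSSAt Y u) {ν : E3} (hν : ν ≠ 0)
    (h0 : inner ℝ ν (partialD 0 Y u) = 0) (h1 : inner ℝ ν (partialD 1 Y u) = 0) {l m n : ℝ}
    (hl : inner ℝ ν (partialD 0 (partialD 0 Y) u) = l)
    (hm : inner ℝ ν (partialD 0 (partialD 1 Y) u) = m)
    (hn : inner ℝ ν (partialD 1 (partialD 1 Y) u) = n) :
    l * n - m ^ 2 ≠ 0 ∧
      inner ℝ ν ν * inner ℝ (Y u) ν * (l * firstForm Y u 1 1 - 2 * m * firstForm Y u 0 1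
        + n * firstForm Y u 0 0)
      + (inner ℝ ν ν * inner ℝ (Y u) (Y u) + inner ℝ (Y u) ν ^ 2) * (l * n - m ^ 2) = 0 := by
  have hc := h.cross_ne_zero
  obtain ⟨k, hk⟩ := exists_smul_cross hc h0 h1
  obtain ⟨hK, hS⟩ := h
  set w := cross (partialD 0 Y u) (partialD 1 Y u) with hw
  have hwn : ‖w‖ ≠ 0 := by simpa using hc
  have hk0 : k ≠ 0 := by
    rintro rfl
    exact hν (by simp [hk])
  have hN : ν = (k * ‖w‖) • unitNormal Y u := by
    rw [hk, unitNormal, ← hw, smul_smul, mul_assoc, mul_inv_cancel₀ hwn, mul_one]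
  have hN1 : inner ℝ (unitNormal Y u) (unitNormal Y u) = 1 := by
    rw [unitNormal, ← hw, real_inner_smul_left, real_inner_smul_right, real_inner_self_eq_norm_sq]
    field_simp
  -- `ν` is `c` times the unit normal, and the equation is homogeneous of degree four in `ν`
  set c := k * ‖w‖ with hcdef
  have hc0 : c ≠ 0 := mul_ne_zero hk0 hwn
  have hD : firstFormDet Y u ≠ 0 := by
    have := norm_cross_sq (partialD 0 Y u) (partialD 1 Y u)
    rw [← hw] at this
    rw [firstFormDet]
    simp only [firstForm]
    rw [← this]
    positivity
  have hl' : l = c * secondForm Y u 0 0 := by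
    rw [← hl, hN, real_inner_smul_left, secondForm, real_inner_comm]
  have hm' : m = c * secondForm Y u 0 1 := by
    rw [← hm, hN, real_inner_smul_left, secondForm, real_inner_comm]
  have hn' : n = c * secondForm Y u 1 1 := by
    rw [← hn, hN, real_inner_smul_left, secondForm, real_inner_comm]
  have hψ : inner ℝ (Y u) ν = c * supportFunction Y u := by
    rw [hN, real_inner_smul_right, supportFunction]
  have hνν : inner ℝ ν ν = c ^ 2 := by
    rw [hN, real_inner_smul_right, real_inner_smul_left, hN1]; ring
  have hKn : secondForm Y u 0 0 * secondForm Y u 1 1 - secondForm Y u 0 1 ^ 2 ≠ 0 := by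
    intro h
    exact hK (by simp [gaussCurvature, h])
  have hΛ : inner ℝ (Y u) (Y u) + 2 * ssRadius Y u * supportFunction Y u = 0 := by
    rw [mem_sphere_iff_norm, zero_sub, norm_neg] at hS
    have h2 := congrArg (· ^ 2) hS
    simp only [sq_abs] at h2
    rw [← real_inner_self_eq_norm_sq, inner_add_left, inner_add_right, inner_add_right,
      real_inner_smul_left, real_inner_smul_right, real_inner_smul_right, real_inner_smul_left,
      hN1, real_inner_comm (Y u) (unitNormal Y u)] at h2
    change inner ℝ (Y u) (Y u) + ssRadius Y u * supportFunction Y u +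
      (ssRadius Y u * supportFunction Y u + _) = _ at h2
    linarith
  constructor
  · rw [hl', hm', hn']
    intro h
    apply mul_ne_zero (pow_ne_zero 2 hc0) hKn
    linear_combination h
  · rw [hψ, hνν, hl', hm', hn']
    simp only [ssRadius, meanCurvature, gaussCurvature] at hΛ
    field_simp at hΛ
    linear_combination c ^ 4 * hΛ

lemma partialD_congr {Y Z : E2 → E3} {u : E2} (i : Fin 2) (h : Y =ᶠ[nhds u] Z) :
    partialD i Y =ᶠ[nhds u] partialD i Z := by
  filter_upwards [h.fderiv (𝕜 := ℝ)] with v hv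
  rw [partialD, partialD, hv]

lemma IsSSAt.congr {Y Z : E2 → E3} {u : E2} (hY : IsSSAt Y u) (h : Y =ᶠ[nhds u] Z) :
    IsSSAt Z u := by
  have h1 := fun i => (partialD_congr i h).self_of_nhds
  have h2 := fun i j => (partialD_congr i (partialD_congr j h)).self_of_nhds
  have h3 := h.self_of_nhds
  simpa only [IsSSAt, ssRadius, gaussCurvature, meanCurvature, supportFunction, firstFormDet,
    firstForm, secondForm, unitNormal, h1, h2, h3] using hY

/-- Partial derivatives commute with a linear isometry of space. -/
lemma partialD_isometry_comp (A : E3 ≃ₗᵢ[ℝ] E3) (c : E3) (Y : E2 → E3) (i : Fin 2) :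
    partialD i (fun u => A (Y u + c)) = fun u => A (partialD i Y u) := by
  funext u
  have := A.comp_fderiv (f := fun u => Y u + c) (x := u)
  simp only [partialD]
  change fderiv ℝ (A ∘ fun u => Y u + c) u _ = _
  rw [this, fderiv_add_const]
  rfl

lemma cross_isometry_eq_zero_iff (A : E3 ≃ₗᵢ[ℝ] E3) (v w : E3) :
    cross (A v) (A w) = 0 ↔ cross v w = 0 := by
  rw [← norm_eq_zero, ← sq_eq_zero_iff, norm_cross_sq, A.inner_map_map, A.inner_map_map,
    A.inner_map_map, ← norm_cross_sq, sq_eq_zero_iff, norm_eq_zero]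

/-! ### Partial derivatives of surfaces of rotation -/

/-- The map `(u₁, u₂) ↦ (ρ(u₁) c(u₂), ρ(u₁) s(u₂), ζ(u₁))`. It is `revolve ρ ζ` for `c = cos` and
`s = sin`, and the class of these maps contains the partial derivatives of `revolve ρ ζ`. -/
noncomputable def spin (ρ ζ c s : ℝ → ℝ) (u : E2) : E3 :=
  !₂[ρ (u 0) * c (u 1), ρ (u 0) * s (u 1), ζ (u 0)]

lemma fderiv_apply_coord {Y : E2 → E3} {u : E2} (h : DifferentiableAt ℝ Y u) (v : E2) (i : Fin 3) :
    fderiv ℝ Y u v i = fderiv ℝ (fun w => Y w i) u v := by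
  have h1 : HasFDerivAt (fun w => Y w i) ((EuclideanSpace.proj i).comp (fderiv ℝ Y u)) u :=
    (EuclideanSpace.proj i : E3 →L[ℝ] ℝ).hasFDerivAt.comp u h.hasFDerivAt
  rw [h1.fderiv]
  rfl

lemma hasFDerivAt_comp_coord {f : ℝ → ℝ} {f' : ℝ} {u : E2} {i : Fin 2}
    (h : HasDerivAt f f' (u i)) :
    HasFDerivAt (fun v : E2 => f (v i))
      (f' • (EuclideanSpace.proj i : E2 →L[ℝ] ℝ)) u :=
  h.comp_hasFDerivAt u (EuclideanSpace.proj i : E2 →L[ℝ] ℝ).hasFDerivAt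

lemma spin_differential {ρ ζ c s : ℝ → ℝ} {ρ' ζ' c' s' : ℝ} {u : E2}
    (hρ : HasDerivAt ρ ρ' (u 0)) (hζ : HasDerivAt ζ ζ' (u 0))
    (hc : HasDerivAt c c' (u 1)) (hs : HasDerivAt s s' (u 1)) :
    DifferentiableAt ℝ (spin ρ ζ c s) u ∧ ∀ v : E2,
    fderiv ℝ (spin ρ ζ c s) u v =
      v 0 • !₂[ρ' * c (u 1), ρ' * s (u 1), ζ'] + v 1 • !₂[ρ (u 0) * c', ρ (u 0) * s', 0] := by
  have hx := (hasFDerivAt_comp_coord hρ).mul (hasFDerivAt_comp_coord hc)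
  have hy := (hasFDerivAt_comp_coord hρ).mul (hasFDerivAt_comp_coord hs)
  have hz := hasFDerivAt_comp_coord hζ
  have hd : DifferentiableAt ℝ (spin ρ ζ c s) u := by
    rw [differentiableAt_euclidean]
    intro i
    fin_cases i
    exacts [hx.differentiableAt, hy.differentiableAt, hz.differentiableAt]
  refine ⟨hd, fun v => ?_⟩
  apply ext_three <;> rw [fderiv_apply_coord hd]
  · refine (congrArg (· v) hx.fderiv).trans ?_
    simp; ring
  · refine (congrArg (· v) hy.fderiv).trans ?_
    simp; ring
  · refine (congrArg (· v) hz.fderiv).trans ?_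
    simp; ring

lemma partialD_zero_spin {ρ ζ c s ρ' ζ' c' s' : ℝ → ℝ}
    (hρ : ∀ t, HasDerivAt ρ (ρ' t) t) (hζ : ∀ t, HasDerivAt ζ (ζ' t) t)
    (hc : ∀ t, HasDerivAt c (c' t) t) (hs : ∀ t, HasDerivAt s (s' t) t) :
    partialD 0 (spin ρ ζ c s) = spin ρ' ζ' c s := by
  funext u
  rw [partialD, (spin_differential (hρ _) (hζ _) (hc _) (hs _)).2]
  simp [spin]

lemma partialD_one_spin {ρ ζ c s ρ' ζ' c' s' : ℝ → ℝ}
    (hρ : ∀ t, HasDerivAt ρ (ρ' t) t) (hζ : ∀ t, HasDerivAt ζ (ζ' t) t)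
    (hc : ∀ t, HasDerivAt c (c' t) t) (hs : ∀ t, HasDerivAt s (s' t) t) :
    partialD 1 (spin ρ ζ c s) = spin ρ (fun _ => 0) c' s' := by
  funext u
  rw [partialD, (spin_differential (hρ _) (hζ _) (hc _) (hs _)).2]
  simp [spin]

lemma inner_spin (ρ ζ c s ρ' ζ' c' s' : ℝ → ℝ) (u : E2) :
    inner ℝ (spin ρ ζ c s u) (spin ρ' ζ' c' s' u) =
      ρ (u 0) * ρ' (u 0) * (c (u 1) * c' (u 1) + s (u 1) * s' (u 1)) + ζ (u 0) * ζ' (u 0) := by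
  simp [inner_eq_sum, spin]; ring

/-- The sphere condition for the surface obtained by rotating the curve `(ρ, ζ)` about the
`x₃`-axis and then applying the isometry `x ↦ A (x + c)`. It is a quadratic polynomial in the
component `c₁ cos u₂ + c₂ sin u₂` of `c` in the radial direction. -/
lemma IsSSAt.revolve_eq {ρ ζ : ℝ → ℝ} (hρ : ContDiff ℝ ∞ ρ) (hζ : ContDiff ℝ ∞ ζ)
    (A : E3 ≃ₗᵢ[ℝ] E3) (c : E3) {u : E2} (h : IsSSAt (fun u => A (revolve ρ ζ u + c)) u)
    {r r' r'' z z' z'' k : ℝ} (hr : ρ (u 0) = r) (hr' : deriv ρ (u 0) = r')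
    (hr'' : deriv (deriv ρ) (u 0) = r'') (hz : ζ (u 0) + c 2 = z) (hz' : deriv ζ (u 0) = z')
    (hz'' : deriv (deriv ζ) (u 0) = z'')
    (hk : c 0 * Real.cos (u 1) + c 1 * Real.sin (u 1) = k) :
    r ≠ 0 ∧ z' ≠ 0 ∧ r' * z'' - z' * r'' ≠ 0 ∧
      (r' ^ 2 + z' ^ 2) * (r' * z - z' * (r + k)) *
          ((r' * z'' - z' * r'') * r + z' * (r' ^ 2 + z' ^ 2)) +
        ((r' ^ 2 + z' ^ 2) * (r ^ 2 + 2 * r * k + c 0 ^ 2 + c 1 ^ 2 + z ^ 2)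
          + (r' * z - z' * (r + k)) ^ 2) * ((r' * z'' - z' * r'') * z') = 0 := by
  have dρ : ∀ t, HasDerivAt ρ (deriv ρ t) t := fun t =>
    (hρ.differentiable (by simp) t).hasDerivAt
  have dζ : ∀ t, HasDerivAt ζ (deriv ζ t) t := fun t =>
    (hζ.differentiable (by simp) t).hasDerivAt
  have dρ' : ∀ t, HasDerivAt (deriv ρ) (deriv (deriv ρ) t) t := fun t =>
    ((contDiff_infty_iff_deriv.1 hρ).2.differentiable (by simp) t).hasDerivAt
  have dζ' : ∀ t, HasDerivAt (deriv ζ) (deriv (deriv ζ) t) t := fun t =>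
    ((contDiff_infty_iff_deriv.1 hζ).2.differentiable (by simp) t).hasDerivAt
  have dc : ∀ t, HasDerivAt Real.cos ((fun t => -Real.sin t) t) t := Real.hasDerivAt_cos
  have ds : ∀ t, HasDerivAt Real.sin (Real.cos t) t := Real.hasDerivAt_sin
  have dc' : ∀ t, HasDerivAt (fun t => -Real.sin t) ((fun t => -Real.cos t) t) t :=
    fun t => (ds t).neg
  have d0 : ∀ t, HasDerivAt (fun _ : ℝ => (0 : ℝ)) ((fun _ => 0) t) t :=
    fun t => hasDerivAt_const t 0
  have hY : revolve ρ ζ = spin ρ ζ Real.cos Real.sin := rfl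
  have hw : cross (partialD 0 (revolve ρ ζ) u) (partialD 1 (revolve ρ ζ) u) ≠ 0 := by
    have h1 := h.cross_ne_zero
    rwa [partialD_isometry_comp, partialD_isometry_comp, Ne, cross_isometry_eq_zero_iff] at h1
  have hcs := Real.cos_sq_add_sin_sq (u 1)
  -- the normal `-ζ' e_r + ρ' e₃` of the rotational surface
  set ν : E3 := spin (fun t => -deriv ζ t) (deriv ρ) Real.cos Real.sin u with hνdef
  have hνν : inner ℝ (A ν) (A ν) = r' ^ 2 + z' ^ 2 := by
    rw [A.inner_map_map, hνdef, inner_spin, hr', hz']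
    linear_combination z' ^ 2 * hcs
  have hA := partialD_isometry_comp A c (revolve ρ ζ)
  have hA2 : ∀ i j, partialD i (partialD j (fun u => A (revolve ρ ζ u + c))) u =
      A (partialD i (partialD j (revolve ρ ζ)) u) := by
    intro i j
    have := partialD_isometry_comp A 0 (partialD j (revolve ρ ζ)) i
    simp only [add_zero] at this
    rw [hA, this]
  have p0 : partialD 0 (revolve ρ ζ) = spin (deriv ρ) (deriv ζ) Real.cos Real.sin :=
    partialD_zero_spin dρ dζ dc ds
  have p1 : partialD 1 (revolve ρ ζ) =
      spin ρ (fun _ => 0) (fun t => -Real.sin t) Real.cos := partialD_one_spin dρ dζ dc ds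
  have p00 : partialD 0 (partialD 0 (revolve ρ ζ)) =
      spin (deriv (deriv ρ)) (deriv (deriv ζ)) Real.cos Real.sin := by
    rw [p0, partialD_zero_spin dρ' dζ' dc ds]
  have p01 : partialD 0 (partialD 1 (revolve ρ ζ)) =
      spin (deriv ρ) (fun _ => 0) (fun t => -Real.sin t) Real.cos := by
    rw [p1, partialD_zero_spin dρ d0 dc' dc]
  have p11 : partialD 1 (partialD 1 (revolve ρ ζ)) =
      spin ρ (fun _ => 0) (fun t => -Real.cos t) (fun t => -Real.sin t) := by
    rw [p1, partialD_one_spin dρ d0 dc' dc]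
  have hν : A ν ≠ 0 := by
    intro h0
    rw [h0, inner_zero_left] at hνν
    have hr0 : r' = 0 := by nlinarith [sq_nonneg r', sq_nonneg z']
    have hz0 : z' = 0 := by nlinarith [sq_nonneg r', sq_nonneg z']
    apply hw
    rw [← norm_eq_zero, ← sq_eq_zero_iff, norm_cross_sq, p0, p1, inner_spin, inner_spin,
      inner_spin, hr', hz', hr0, hz0]
    ring
  have key := h.of_normal hν (l := r' * z'' - z' * r'') (m := 0) (n := r * z')
    (by rw [hA, A.inner_map_map, hνdef, p0, inner_spin, hr', hz']
        linear_combination (-z' * r') * hcs)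
    (by rw [hA, A.inner_map_map, hνdef, p1, inner_spin, hr', hz', hr]; ring)
    (by rw [hA2, A.inner_map_map, hνdef, p00, inner_spin, hr', hz', hr'', hz'']
        linear_combination (-z' * r'') * hcs)
    (by rw [hA2, A.inner_map_map, hνdef, p01, inner_spin, hr', hz']; ring)
    (by rw [hA2, A.inner_map_map, hνdef, p11, inner_spin, hr', hz', hr]
        linear_combination (r * z') * hcs)
  have hψ : inner ℝ (A (revolve ρ ζ u + c)) (A ν) = r' * z - z' * (r + k) := by
    rw [A.inner_map_map, inner_add_left, hνdef, hY, inner_spin, inner_eq_sum, hr, hr', hz',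
      ← hz, ← hk]
    simp only [spin, PiLp.toLp_apply, Matrix.cons_val_zero, Matrix.cons_val_one, Matrix.cons_val,
      hr', hz']
    linear_combination (-r * z') * hcs
  have hΛ : inner ℝ (A (revolve ρ ζ u + c)) (A (revolve ρ ζ u + c)) =
      r ^ 2 + 2 * r * k + c 0 ^ 2 + c 1 ^ 2 + z ^ 2 := by
    rw [A.inner_map_map, inner_eq_sum, ← hk, ← hz]
    simp only [revolve, PiLp.add_apply, Matrix.cons_val_zero, Matrix.cons_val_one,
      Matrix.cons_val, hr]
    linear_combination r ^ 2 * hcs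
  have hE : firstForm (fun u => A (revolve ρ ζ u + c)) u 0 0 = r' ^ 2 + z' ^ 2 := by
    rw [firstForm, hA, A.inner_map_map, p0, inner_spin, hr', hz']
    linear_combination r' ^ 2 * hcs
  have hG : firstForm (fun u => A (revolve ρ ζ u + c)) u 1 1 = r ^ 2 := by
    rw [firstForm, hA, A.inner_map_map, p1, inner_spin, hr]
    linear_combination r ^ 2 * hcs
  rw [hψ, hΛ, hE, hG, hνν] at key
  obtain ⟨k1, k2⟩ := key
  have n1 : r ≠ 0 := by rintro rfl; simp at k1
  refine ⟨n1, by rintro rfl; simp at k1, fun h => by rw [h] at k1; simp at k1, ?_⟩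
  apply mul_left_cancel₀ n1
  linear_combination k2

/-! ### The generating curve -/

lemma profileM_eq (a b t : ℝ) :
    profileM a b t = Real.exp (a * t + b) * (1 / Real.cosh t - a * Real.sinh t) := by
  have h : Real.exp t ≠ 0 := (Real.exp_pos t).ne'
  have h2 : 1 + Real.exp t ^ 2 ≠ 0 := by positivity
  have h3 : Real.exp (2 * t) = Real.exp t ^ 2 := by rw [two_mul, Real.exp_add, sq]
  rw [profileM, Real.cosh_eq, Real.sinh_eq, Real.exp_neg, h3]
  generalize Real.exp t = x at *
  field_simp
  ring

lemma profileN_eq (a b t : ℝ) :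
    profileN a b t = Real.exp (a * t + b) * (-(Real.sinh t / Real.cosh t) - a) := by
  have h : Real.exp t ≠ 0 := (Real.exp_pos t).ne'
  have h2 : 1 + Real.exp t ^ 2 ≠ 0 := by positivity
  have h3 : Real.exp (2 * t) = Real.exp t ^ 2 := by rw [two_mul, Real.exp_add, sq]
  rw [profileN, Real.cosh_eq, Real.sinh_eq, Real.exp_neg, h3]
  generalize Real.exp t = x at *
  field_simp
  ring

/-- A plane curve `(ρ, ζ)` whose surface of rotation satisfies the SS-condition, normalized so
that the normal with positive support function points away from the axis, is a reparametrization
of some profile `(M, N)`. The parameter is `τ = arsinh (ρ' / ζ')`, for which the outward normal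
is `(1 / cosh τ, -tanh τ)`. The support function is `ψ = (ρ - ζ sinh τ) / cosh τ`; the
SS-condition says that `log ψ` is an affine function `a τ + b`, and `(ρ, ζ)` is recovered from `ψ`
as the envelope of its tangent lines. -/
lemma exists_profile_of_pos {ρ ζ : ℝ → ℝ} (hρ : ContDiff ℝ ∞ ρ) (hζ : ContDiff ℝ ∞ ζ) {I : Set ℝ}
    (hI : IsOpen I) (hIc : IsPreconnected I) {t₀ : ℝ} (ht₀ : t₀ ∈ I)
    (hz : ∀ t ∈ I, deriv ζ t ≠ 0)
    (hD : ∀ t ∈ I, deriv ρ t * deriv (deriv ζ) t - deriv ζ t * deriv (deriv ρ) t ≠ 0)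
    (hpos : ∀ t ∈ I, 0 < ρ t - deriv ρ t / deriv ζ t * ζ t)
    (hS : ∀ t ∈ I, (deriv ρ t ^ 2 + deriv ζ t ^ 2) * (deriv ρ t * ζ t - deriv ζ t * ρ t) *
          ((deriv ρ t * deriv (deriv ζ) t - deriv ζ t * deriv (deriv ρ) t) * ρ t +
            deriv ζ t * (deriv ρ t ^ 2 + deriv ζ t ^ 2)) +
        ((deriv ρ t ^ 2 + deriv ζ t ^ 2) * (ρ t ^ 2 + ζ t ^ 2) +
          (deriv ρ t * ζ t - deriv ζ t * ρ t) ^ 2) *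
          ((deriv ρ t * deriv (deriv ζ) t - deriv ζ t * deriv (deriv ρ) t) * deriv ζ t) = 0) :
    ∃ (a b : ℝ) (τ : ℝ → ℝ), (∀ t ∈ I, ContDiffAt ℝ ∞ τ t) ∧ deriv τ t₀ ≠ 0 ∧
      ∀ t ∈ I, ρ t = profileM a b (τ t) ∧ ζ t = profileN a b (τ t) := by
  have hρ1 := (contDiff_infty_iff_deriv.1 hρ).2
  have hζ1 := (contDiff_infty_iff_deriv.1 hζ).2
  set q : ℝ → ℝ := fun t => deriv ρ t / deriv ζ t with hq
  set q' : ℝ → ℝ := fun t =>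
    (deriv (deriv ρ) t * deriv ζ t - deriv ρ t * deriv (deriv ζ) t) / deriv ζ t ^ 2 with hq'
  set c : ℝ → ℝ := fun t => √(1 + q t ^ 2) with hc
  set Q : ℝ → ℝ := fun t => ρ t - q t * ζ t with hQ
  set τ : ℝ → ℝ := fun t => Real.arsinh (q t) with hτ
  clear_value τ Q c q' q
  have cpos : ∀ t, 0 < c t := fun t => hc ▸ Real.sqrt_pos.2 (by positivity)
  have csq : ∀ t, c t ^ 2 = 1 + q t ^ 2 := fun t => hc ▸ Real.sq_sqrt (by positivity)
  have dζ : ∀ t, HasDerivAt ζ (deriv ζ t) t := fun t =>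
    (hζ.differentiable (by simp) t).hasDerivAt
  have dq : ∀ t ∈ I, HasDerivAt q (q' t) t := fun t ht => by
    rw [hq, hq']
    exact (hρ1.differentiable (by simp) t).hasDerivAt.fun_div
      (hζ1.differentiable (by simp) t).hasDerivAt (hz t ht)
  have dc : ∀ t ∈ I, HasDerivAt c (q t * q' t / c t) t := by
    intro t ht
    have := (((dq t ht).fun_pow 2).const_add 1).sqrt (by positivity)
    have hcne := (cpos t).ne'
    rw [hc] at hcne ⊢
    refine this.congr_deriv ?_
    norm_num
    field_simp
  have dτ : ∀ t ∈ I, HasDerivAt τ (q' t / c t) t := by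
    intro t ht
    rw [hτ, hc]
    exact (dq t ht).arsinh.congr_deriv (by rw [smul_eq_mul, div_eq_inv_mul])
  have hq0 : ∀ t ∈ I, deriv ρ t = q t * deriv ζ t := fun t ht => by
    rw [hq]; field_simp [hz t ht]
  have dQ : ∀ t ∈ I, HasDerivAt Q (-(q' t * ζ t)) t := by
    intro t ht
    have := (hρ.differentiable (by simp) t).hasDerivAt.fun_sub ((dq t ht).fun_mul (dζ t))
    rw [hQ]
    exact this.congr_deriv (by rw [hq0 t ht]; ring)
  have hQpos : ∀ t ∈ I, 0 < Q t := by simpa only [hQ, hq] using hpos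
  have hD' : ∀ t ∈ I, deriv ρ t * deriv (deriv ζ) t - deriv ζ t * deriv (deriv ρ) t =
      -deriv ζ t ^ 2 * q' t := fun t ht => by
    have := hz t ht
    rw [hq']; field_simp; ring
  have q'ne : ∀ t ∈ I, q' t ≠ 0 := fun t ht h => hD t ht (by rw [hD' t ht, h]; ring)
  -- the SS-condition in terms of the slope `q` and the intercept `Q`
  have hS' : ∀ t ∈ I, q' t * (q t * ζ t * Q t + c t ^ 2 * ζ t ^ 2 + Q t ^ 2 / c t ^ 2)
      + deriv ζ t * Q t * c t ^ 2 = 0 := by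
    intro t ht
    have h := hS t ht
    have hρQ : ρ t = Q t + q t * ζ t := by simp [hQ]
    have hcne := (cpos t).ne'
    rw [hD' t ht, hq0 t ht, hρQ] at h
    apply mul_left_cancel₀ (mul_ne_zero (pow_ne_zero 5 (hz t ht)) (pow_ne_zero 2 hcne))
    rw [mul_zero]
    have e : c t ^ 2 * (q' t * (q t * ζ t * Q t + c t ^ 2 * ζ t ^ 2 + Q t ^ 2 / c t ^ 2)
      + deriv ζ t * Q t * c t ^ 2) =
        q' t * (c t ^ 2 * (q t * ζ t * Q t) + (c t ^ 2) ^ 2 * ζ t ^ 2 + Q t ^ 2)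
          + deriv ζ t * Q t * (c t ^ 2) ^ 2 := by
      field_simp
    rw [mul_assoc, e, csq]
    linear_combination (-1) * h
  -- the logarithmic derivative of `ψ = Q / c` with respect to `τ`
  set α : ℝ → ℝ := fun t => -(q t / c t) - ζ t * c t / Q t with hα
  have dα : ∀ t ∈ I, HasDerivAt α 0 t := by
    intro t ht
    have hcne := (cpos t).ne'
    have hQne : Q t ≠ 0 := (hQpos t ht).ne'
    have := (((dq t ht).fun_div (dc t ht) hcne).fun_neg).fun_sub
      (((dζ t).fun_mul (dc t ht)).fun_div (dQ t ht) hQne)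
    refine this.congr_deriv ?_
    have h := hS' t ht
    have h2 := csq t
    field_simp at h ⊢
    linear_combination (-1) * h - q' t * Q t ^ 2 * h2
  obtain ⟨a, ha⟩ := hI.exists_is_const_of_deriv_eq_zero hIc
    (fun t ht => (dα t ht).differentiableAt.differentiableWithinAt) (fun t ht => (dα t ht).deriv)
  set β : ℝ → ℝ := fun t => Real.log (Q t / c t) - a * τ t with hβ
  have dβ : ∀ t ∈ I, HasDerivAt β 0 t := by
    intro t ht
    have hcne := (cpos t).ne'
    have hQne : Q t ≠ 0 := (hQpos t ht).ne'
    have := (((dQ t ht).fun_div (dc t ht) hcne).log (by positivity)).fun_sub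
      ((dτ t ht).const_mul a)
    refine this.congr_deriv ?_
    rw [← ha t ht, hα]
    field_simp
    ring
  obtain ⟨b, hb⟩ := hI.exists_is_const_of_deriv_eq_zero hIc
    (fun t ht => (dβ t ht).differentiableAt.differentiableWithinAt) (fun t ht => (dβ t ht).deriv)
  refine ⟨a, b, τ, fun t ht => ?_, ?_, fun t ht => ?_⟩
  · rw [hτ, hq]
    exact (hρ1.contDiffAt.div hζ1.contDiffAt (hz t ht)).arsinh
  · rw [(dτ t₀ ht₀).deriv]
    exact div_ne_zero (q'ne t₀ ht₀) (cpos t₀).ne'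
  · have hcne := (cpos t).ne'
    have hQne : 0 < Q t := hQpos t ht
    have hψ : Real.exp (a * τ t + b) = Q t / c t := by
      rw [← hb t ht, hβ, add_sub_cancel, Real.exp_log (div_pos hQne (cpos t))]
    have hcosh : Real.cosh (τ t) = c t := by rw [hτ, hc, Real.cosh_arsinh]
    have hsinh : Real.sinh (τ t) = q t := by rw [hτ, Real.sinh_arsinh]
    have h2 := csq t
    rw [profileM_eq, profileN_eq, hψ, hcosh, hsinh, ← ha t ht, hα]
    constructor
    · have : ρ t = Q t + q t * ζ t := by simp [hQ]
      rw [this]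
      field_simp
      linear_combination Q t * h2
    · field_simp
      ring

/-- The normalization in `exists_profile_of_pos` is achieved by replacing `ρ` with `-ρ` if
necessary, since the SS-condition prevents the support function from vanishing off the axis. -/
lemma exists_profile {ρ ζ : ℝ → ℝ} (hρ : ContDiff ℝ ∞ ρ) (hζ : ContDiff ℝ ∞ ζ) {t₀ : ℝ}
    (h : ∀ᶠ t in 𝓝 t₀, ρ t ≠ 0 ∧ deriv ζ t ≠ 0 ∧
      deriv ρ t * deriv (deriv ζ) t - deriv ζ t * deriv (deriv ρ) t ≠ 0 ∧
      (deriv ρ t ^ 2 + deriv ζ t ^ 2) * (deriv ρ t * ζ t - deriv ζ t * ρ t) *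
          ((deriv ρ t * deriv (deriv ζ) t - deriv ζ t * deriv (deriv ρ) t) * ρ t +
            deriv ζ t * (deriv ρ t ^ 2 + deriv ζ t ^ 2)) +
        ((deriv ρ t ^ 2 + deriv ζ t ^ 2) * (ρ t ^ 2 + ζ t ^ 2) +
          (deriv ρ t * ζ t - deriv ζ t * ρ t) ^ 2) *
          ((deriv ρ t * deriv (deriv ζ) t - deriv ζ t * deriv (deriv ρ) t) * deriv ζ t) = 0) :
    ∃ (a b ε : ℝ) (τ : ℝ → ℝ), (ε = 1 ∨ ε = -1) ∧ deriv τ t₀ ≠ 0 ∧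
      ∀ᶠ t in 𝓝 t₀, ContDiffAt ℝ ∞ τ t ∧
        ρ t = ε * profileM a b (τ t) ∧ ζ t = profileN a b (τ t) := by
  obtain ⟨h0, hz0, hD0, hS0⟩ := h.self_of_nhds
  have hρ1 := (contDiff_infty_iff_deriv.1 hρ).2
  have hζ1 := (contDiff_infty_iff_deriv.1 hζ).2
  -- where `ψ` vanishes, the SS-condition forces `Λ = 0`, that is a point of the axis
  have hQ0 : ρ t₀ - deriv ρ t₀ / deriv ζ t₀ * ζ t₀ ≠ 0 := by
    intro hQ
    have hP : deriv ρ t₀ * ζ t₀ - deriv ζ t₀ * ρ t₀ = 0 := by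
      field_simp at hQ
      linear_combination -hQ
    rw [hP] at hS0
    have hw : 0 < deriv ρ t₀ ^ 2 + deriv ζ t₀ ^ 2 := by positivity
    have hΛ : 0 < ρ t₀ ^ 2 + ζ t₀ ^ 2 := by positivity
    apply mul_ne_zero (mul_ne_zero hw.ne' hΛ.ne') (mul_ne_zero hD0 hz0)
    linear_combination hS0
  have hQc : ContinuousAt (fun t => ρ t - deriv ρ t / deriv ζ t * ζ t) t₀ :=
    hρ.continuous.continuousAt.sub ((hρ1.continuous.continuousAt.div hζ1.continuous.continuousAt
      hz0).mul hζ.continuous.continuousAt)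
  rcases hQ0.lt_or_gt with hneg | hpos
  · obtain ⟨r, hr, hI⟩ := Metric.eventually_nhds_iff_ball.1
      (h.and (hQc.eventually (gt_mem_nhds hneg)))
    have hd : deriv (fun t => -ρ t) = fun t => -deriv ρ t := deriv.fun_neg'
    have hdd : deriv (fun t => -deriv ρ t) = fun t => -deriv (deriv ρ) t := deriv.fun_neg'
    obtain ⟨a, b, τ, h1, h2, h3⟩ := exists_profile_of_pos hρ.neg hζ Metric.isOpen_ball
      (convex_ball t₀ r).isPreconnected (Metric.mem_ball_self hr) (fun t ht => (hI t ht).1.2.1)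
      (fun t ht => by
        have := (hI t ht).1.2.2.1
        rw [hd, hdd]
        contrapose! this
        linear_combination -this)
      (fun t ht => by
        have := (hI t ht).2
        rw [hd]
        have e : -ρ t - -deriv ρ t / deriv ζ t * ζ t =
          -(ρ t - deriv ρ t / deriv ζ t * ζ t) := by ring
        rw [e]
        exact neg_pos.2 this)
      (fun t ht => by
        rw [hd, hdd]
        linear_combination -(hI t ht).1.2.2.2)
    exact ⟨a, b, -1, τ, Or.inr rfl, h2, Filter.mem_of_superset (Metric.ball_mem_nhds t₀ hr)
      fun t ht => ⟨h1 t ht, by linear_combination -(h3 t ht).1, (h3 t ht).2⟩⟩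
  · obtain ⟨r, hr, hI⟩ := Metric.eventually_nhds_iff_ball.1
      (h.and (hQc.eventually (lt_mem_nhds hpos)))
    obtain ⟨a, b, τ, h1, h2, h3⟩ := exists_profile_of_pos hρ hζ Metric.isOpen_ball
      (convex_ball t₀ r).isPreconnected (Metric.mem_ball_self hr) (fun t ht => (hI t ht).1.2.1)
      (fun t ht => (hI t ht).1.2.2.1) (fun t ht => (hI t ht).2) (fun t ht => (hI t ht).1.2.2.2)
    exact ⟨a, b, 1, τ, Or.inl rfl, h2, Filter.mem_of_superset (Metric.ball_mem_nhds t₀ hr)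
      fun t ht => ⟨h1 t ht, by rw [one_mul]; exact (h3 t ht).1, (h3 t ht).2⟩⟩

/-! ### Local classification off the axis -/

variable {M : Type*} [TopologicalSpace M] [ChartedSpace E2 M]

/-- Change of coordinates: a parametrization may be precomposed with a local diffeomorphism. -/
lemma IsParametrizedNear.reparam [IsManifold (𝓡 2) ∞ M] {X : M → E3} {Y Y' : E2 → E3} {p : M}
    {σ : OpenPartialHomeomorph M E2} (hσ : σ ∈ IsManifold.maximalAtlas (𝓡 2) ∞ M)
    (hp : p ∈ σ.source) (hX : ∀ q ∈ σ.source, X q = Y (σ q)) {φ : E2 → E2}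
    {φ' : E2 ≃L[ℝ] E2} (hφ' : HasFDerivAt φ (φ' : E2 →L[ℝ] E2) (σ p))
    (hφ : ∀ᶠ u in 𝓝 (σ p), ContDiffAt ℝ ∞ φ u ∧ Y u = Y' (φ u)) :
    IsParametrizedNear X Y' p := by
  have hφp : ContDiffAt ℝ ∞ φ (σ p) := hφ.self_of_nhds.1
  have hinv : ∀ᶠ u in 𝓝 (σ p), fderiv ℝ φ u ∈ Set.range ((↑) : (E2 ≃L[ℝ] E2) → E2 →L[ℝ] E2) :=
    (hφp.continuousAt_fderiv (by simp)).eventually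
      (ContinuousLinearEquiv.isOpen.mem_nhds ⟨φ', hφ'.fderiv.symm⟩)
  obtain ⟨s, hs, hso, hps⟩ := eventually_nhds_iff.1 (hφ.and hinv)
  set e := hφp.toOpenPartialHomeomorph φ hφ' (by simp)
  have hpe : σ p ∈ e.source := hφp.mem_toOpenPartialHomeomorph_source hφ' (by simp)
  set e' := e.restrOpen s hso
  have h1 : ContMDiffOn (𝓡 2) (𝓡 2) ∞ e' e'.source := by
    intro u hu
    exact (hs u hu.2).1.1.contMDiffAt.contMDiffWithinAt
  have h2 : ContMDiffOn (𝓡 2) (𝓡 2) ∞ e'.symm e'.target := by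
    intro v hv
    have hu := e'.map_target hv
    obtain ⟨⟨hd, _⟩, ψ, hψ⟩ := hs _ hu.2
    have : HasFDerivAt e' (ψ : E2 →L[ℝ] E2) (e'.symm v) := by
      rw [hψ]
      exact (hd.differentiableAt (by simp)).hasFDerivAt
    exact (e'.contDiffAt_symm hv this hd).contMDiffAt.contMDiffWithinAt
  refine ⟨σ.trans e', ?_, ⟨hp, hpe, hps⟩, fun q hq => ?_⟩
  · rw [IsManifold.mem_maximalAtlas_iff_contMDiffOn] at hσ ⊢
    rw [OpenPartialHomeomorph.trans_source, OpenPartialHomeomorph.trans_target,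
      OpenPartialHomeomorph.coe_trans, OpenPartialHomeomorph.coe_trans_symm]
    exact ⟨h1.comp (hσ.1.mono Set.inter_subset_left) fun q hq => hq.2,
      hσ.2.comp (h2.mono Set.inter_subset_left) fun q hq => hq.2⟩
  · exact (hX q hq.1).trans (hs _ hq.2.2).1.2

/-- In the coordinates `σ` given by a parametrization `Y`, the SS-condition holds for `Y`. -/
lemma IsSSSurface.isSSAt {X : M → E3} (hX : IsSSSurface X) {Y : E2 → E3}
    {σ : OpenPartialHomeomorph M E2} (hσ : σ ∈ IsManifold.maximalAtlas (𝓡 2) ∞ M)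
    (h : ∀ q ∈ σ.source, X q = Y (σ q)) {u : E2} (hu : u ∈ σ.target) : IsSSAt Y u := by
  refine (hX.2 σ hσ u hu).congr ?_
  filter_upwards [σ.open_target.mem_nhds hu] with v hv
  rw [h _ (σ.map_target hv), σ.right_inv hv]

/-- The straight segment through `u` in the `i`-th coordinate direction. -/
noncomputable def coordLine (i : Fin 2) (u : E2) (t : ℝ) : E2 :=
  u + (t - u i) • EuclideanSpace.single i 1

lemma coordLine_self (i : Fin 2) (u : E2) : coordLine i u (u i) = u := by simp [coordLine]

lemma continuous_coordLine (i : Fin 2) (u : E2) : Continuous (coordLine i u) := by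
  unfold coordLine
  fun_prop

lemma coordLine_apply (i j : Fin 2) (u : E2) (t : ℝ) :
    coordLine i u t j = if j = i then t else u j := by
  by_cases h : j = i <;> simp [coordLine, h]

/-- Around a point off the axis, an SS-surface of rotation about an axis through the origin is
parametrized by a member of the explicit family. -/
lemma exists_isParametrizedNear_rotationalSS [IsManifold (𝓡 2) ∞ M] {X : M → E3}
    (hX : IsSSSurface X) (A : E3 ≃ₗᵢ[ℝ] E3) {ρ ζ : ℝ → ℝ} (hρ : ContDiff ℝ ∞ ρ)
    (hζ : ContDiff ℝ ∞ ζ) {p : M} (h : IsParametrizedNear X (fun u => A (revolve ρ ζ u)) p) :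
    ∃ a b : ℝ, IsParametrizedNear X (fun u => A (rotationalSS a b u)) p := by
  obtain ⟨σ, hσ, hp, hXσ⟩ := h
  have hcurve : ∀ᶠ t in 𝓝 (σ p 0), coordLine 0 (σ p) t ∈ σ.target :=
    (continuous_coordLine 0 (σ p)).continuousAt.eventually (by
      rw [coordLine_self]
      exact σ.open_target.mem_nhds (σ.map_source hp))
  obtain ⟨a, b, ε, τ, hε, hτ', hev⟩ := exists_profile hρ hζ (t₀ := σ p 0) (by
    filter_upwards [hcurve] with t ht
    have hS := hX.isSSAt (Y := fun u => A (revolve ρ ζ u)) hσ hXσ ht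
    have := IsSSAt.revolve_eq hρ hζ A 0 (by simpa using hS) rfl rfl rfl rfl rfl rfl rfl
    simp only [coordLine_apply, PiLp.zero_apply] at this
    simp at this
    refine ⟨this.1, this.2.1, this.2.2.1, ?_⟩
    linear_combination this.2.2.2)
  -- the sign `ε` is absorbed by a half-turn about the axis
  obtain ⟨θ, hc, hs⟩ : ∃ θ : ℝ, (∀ x, ε * Real.cos x = Real.cos (x + θ)) ∧
      ∀ x, ε * Real.sin x = Real.sin (x + θ) := by
    rcases hε with rfl | rfl
    · exact ⟨0, by simp, by simp⟩
    · exact ⟨Real.pi, by simp, by simp⟩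
  have hτd : HasDerivAt τ (deriv τ (σ p 0)) (σ p 0) :=
    (hev.self_of_nhds.1.differentiableAt (by simp)).hasDerivAt
  -- the change of coordinates `(t, θ) ↦ (τ(t), θ + θ₀)` with `θ₀ ∈ {0, π}`
  set φ : E2 → E2 := fun u => !₂[τ (u 0), u 1 + θ] with hφ
  set d := deriv τ (σ p 0)
  let φ' : E2 ≃L[ℝ] E2 := (LinearEquiv.ofBijective
    ({ toFun := fun v => !₂[d * v 0, v 1]
       map_add' := fun v w => by ext i; fin_cases i <;> simp [mul_add]
       map_smul' := fun c v => by ext i; fin_cases i <;> simp [mul_left_comm] } : E2 →ₗ[ℝ] E2)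
    (by
      rw [Function.Bijective, LinearMap.injective_iff_surjective, and_self,
        ← LinearMap.injective_iff_surjective, injective_iff_map_eq_zero]
      intro v hv
      have h0 := congrArg (· 0) hv
      have h1 := congrArg (· 1) hv
      simp [hτ'] at h0 h1
      ext i; fin_cases i <;> simp [h0, h1])).toContinuousLinearEquiv
  refine ⟨a, b, IsParametrizedNear.reparam (Y := fun u => A (revolve ρ ζ u)) hσ hp hXσ
    (φ := φ) (φ' := φ') ?_ ?_⟩
  · rw [← hasFDerivWithinAt_univ, hasFDerivWithinAt_euclidean]
    simp only [hasFDerivWithinAt_univ]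
    intro i
    fin_cases i
    · exact (hasFDerivAt_comp_coord hτd).congr_fderiv (by ext v; rfl)
    · exact ((hasFDerivAt_comp_coord (hasDerivAt_id (σ p 1))).add_const θ).congr_fderiv
        (by ext v; simp [φ'])
  · have h0 : Filter.Tendsto (fun u : E2 => u 0) (𝓝 (σ p)) (𝓝 (σ p 0)) :=
      (EuclideanSpace.proj 0 : E2 →L[ℝ] ℝ).continuous.continuousAt
    filter_upwards [h0.eventually hev] with u hu
    constructor
    · rw [contDiffAt_euclidean]
      intro i
      fin_cases i
      · exact hu.1.comp u (EuclideanSpace.proj 0 : E2 →L[ℝ] ℝ).contDiff.contDiffAt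
      · exact ((EuclideanSpace.proj 1 : E2 →L[ℝ] ℝ).contDiff.add contDiff_const).contDiffAt
    · simp only [rotationalSS, revolve, hφ, hu.2.1, hu.2.2, mul_assoc, mul_left_comm ε, hc, hs]
      simp only [Matrix.cons_val_zero, Matrix.cons_val_one, ← hc, ← hs]

/-! ### The explicit family and its Gauss map -/

/-- The outward unit normal of `rotationalSS a b`, which depends neither on `a` nor on `b`. -/
noncomputable def familyNormal : E2 → E3 :=
  spin (fun t => 1 / Real.cosh t) (fun t => -(Real.sinh t / Real.cosh t)) Real.cos Real.sin

lemma weierT_exp (u : E2) :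
    weierT Complex.exp ((u 0 : ℂ) + (u 1 : ℂ) * Complex.I) = 1 + Real.exp (u 0) ^ 2 := by
  simp [weierT, Complex.norm_exp]

lemma weierNormal_exp (u : E2) :
    weierNormal Complex.exp ((u 0 : ℂ) + (u 1 : ℂ) * Complex.I) = familyNormal u := by
  have h : Real.exp (u 0) ≠ 0 := (Real.exp_pos _).ne'
  rw [weierNormal, weierT_exp]
  apply ext_three <;>
    simp only [ofComplexReal, familyNormal, spin, Real.cosh_eq, Real.sinh_eq, Real.exp_neg] <;>
    simp [Complex.exp_re, Complex.exp_im] <;>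
    generalize Real.exp (u 0) = x at * <;>
    have h2 : 1 + x ^ 2 ≠ 0 := by positivity
  all_goals
    field_simp
    try ring

lemma weierSurface_exp (a : ℝ) (z₀ : ℂ) (u : E2) :
    weierSurface (fun z => a * z + z₀) Complex.exp ((u 0 : ℂ) + (u 1 : ℂ) * Complex.I) =
      rotationalSS a z₀.re u := by
  have hd : deriv (fun z : ℂ => (a : ℂ) * z + z₀) = fun _ => (a : ℂ) := by
    funext z
    simp
  rw [weierSurface, weierNormal_exp, weierT_exp, hd, Complex.deriv_exp]
  have hin : inner ℝ (Complex.exp ((u 0 : ℂ) + (u 1 : ℂ) * Complex.I))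
      (Complex.exp ((u 0 : ℂ) + (u 1 : ℂ) * Complex.I) * a) = a * Real.exp (u 0) ^ 2 := by
    have hcs := Real.cos_sq_add_sin_sq (u 1)
    rw [Complex.inner]
    simp [Complex.exp_re, Complex.exp_im]
    linear_combination a * Real.exp (u 0) ^ 2 * hcs
  have hn : ‖Complex.exp ((u 0 : ℂ) + (u 1 : ℂ) * Complex.I)‖ = Real.exp (u 0) := by
    simp [Complex.norm_exp]
  have hf : ((a : ℂ) * ((u 0 : ℂ) + (u 1 : ℂ) * Complex.I) + z₀).re = a * u 0 + z₀.re := by simp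
  have h : Real.exp (u 0) ≠ 0 := (Real.exp_pos _).ne'
  rw [hin, hn, hf]
  generalize hr : a * Real.exp (u 0) ^ 2 = r
  generalize hT : 1 + Real.exp (u 0) ^ 2 = T
  apply ext_three <;>
    simp only [rotationalSS, revolve, profileM_eq, profileN_eq, ofComplexReal, familyNormal, spin,
      Real.cosh_eq, Real.sinh_eq, Real.exp_neg] <;>
    simp [Complex.exp_re, Complex.exp_im] <;>
    rw [← hr] <;>
    try rw [← hT]
  all_goals
    clear hr hT
    generalize Real.exp (u 0) = x at *
    have h2 : 1 + x ^ 2 ≠ 0 := by positivity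
    field_simp
    ring

lemma inner_familyNormal_self (u : E2) : inner ℝ (familyNormal u) (familyNormal u) = 1 := by
  have hc := (Real.cosh_pos (u 0)).ne'
  have h1 := Real.cosh_sq (u 0)
  rw [familyNormal, inner_spin, ← sq, ← sq, ← sq, ← sq, Real.cos_sq_add_sin_sq]
  field_simp
  linear_combination -h1

/-- The support function of `rotationalSS a b` is `e ^ (a u₁ + b)`. -/
lemma inner_rotationalSS_familyNormal (a b : ℝ) (u : E2) :
    inner ℝ (rotationalSS a b u) (familyNormal u) = Real.exp (a * u 0 + b) := by
  have hc := (Real.cosh_pos (u 0)).ne'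
  have h1 := Real.cosh_sq (u 0)
  have e : rotationalSS a b = spin (profileM a b) (profileN a b) Real.cos Real.sin := rfl
  rw [e, familyNormal, inner_spin, ← sq, ← sq, Real.cos_sq_add_sin_sq, profileM_eq, profileN_eq]
  field_simp
  linear_combination -h1

lemma contDiff_profileM (a b : ℝ) : ContDiff ℝ ∞ (profileM a b) := by
  unfold profileM
  have h1 : ∀ t, 2 * Real.exp t ≠ 0 := fun t => by positivity
  have h2 : ∀ t, 1 + Real.exp (2 * t) ≠ 0 := fun t => by positivity
  fun_prop (disch := assumption)

lemma contDiff_profileN (a b : ℝ) : ContDiff ℝ ∞ (profileN a b) := by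
  unfold profileN
  have h2 : ∀ t, 1 + Real.exp (2 * t) ≠ 0 := fun t => by positivity
  fun_prop (disch := assumption)

lemma hasDerivAt_profileM (a b t : ℝ) : HasDerivAt (profileM a b)
    (Real.exp (a * t + b) * (a * (1 / Real.cosh t - a * Real.sinh t)
      - Real.sinh t / Real.cosh t ^ 2 - a * Real.cosh t)) t := by
  have hc := (Real.cosh_pos t).ne'
  rw [show profileM a b = _ from funext (profileM_eq a b)]
  have h1 : HasDerivAt (fun t => a * t + b) a t := by
    simpa using ((hasDerivAt_id t).const_mul a).add_const b
  refine (h1.exp.fun_mul (((hasDerivAt_const t (1 : ℝ)).fun_div (Real.hasDerivAt_cosh t)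
    hc).fun_sub ((Real.hasDerivAt_sinh t).const_mul a))).congr_deriv ?_
  field_simp
  ring

lemma hasDerivAt_profileN (a b t : ℝ) : HasDerivAt (profileN a b)
    (Real.exp (a * t + b) * (a * (-(Real.sinh t / Real.cosh t) - a) - 1 / Real.cosh t ^ 2)) t := by
  have hc := (Real.cosh_pos t).ne'
  rw [show profileN a b = _ from funext (profileN_eq a b)]
  have h1 : HasDerivAt (fun t => a * t + b) a t := by
    simpa using ((hasDerivAt_id t).const_mul a).add_const b
  refine (h1.exp.fun_mul (((Real.hasDerivAt_sinh t).fun_div (Real.hasDerivAt_cosh t)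
    hc).fun_neg.sub_const a)).congr_deriv ?_
  have h2 := Real.cosh_sq t
  field_simp
  linear_combination -h2

lemma inner_familyNormal_fderiv (a b : ℝ) (u v : E2) :
    inner ℝ (familyNormal u) (fderiv ℝ (rotationalSS a b) u v) = 0 := by
  have hc := (Real.cosh_pos (u 0)).ne'
  have h1 := Real.cosh_sq (u 0)
  have hcs := Real.cos_sq_add_sin_sq (u 1)
  have e : rotationalSS a b = spin (profileM a b) (profileN a b) Real.cos Real.sin := rfl
  rw [e, (spin_differential (hasDerivAt_profileM a b _) (hasDerivAt_profileN a b _)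
    (Real.hasDerivAt_cos _) (Real.hasDerivAt_sin _)).2, inner_add_right, real_inner_smul_right,
    real_inner_smul_right, inner_eq_sum, inner_eq_sum]
  simp only [familyNormal, spin, Matrix.cons_val_zero, Matrix.cons_val_one, Matrix.cons_val]
  field_simp
  rw [hcs]
  linear_combination -(v 0 * Real.exp (a * u 0 + b) * Real.cosh (u 0) * a) * h1

lemma differentiable_revolve {ρ ζ : ℝ → ℝ} (hρ : ContDiff ℝ ∞ ρ) (hζ : ContDiff ℝ ∞ ζ) :
    Differentiable ℝ (revolve ρ ζ) := fun u =>
  (spin_differential (hρ.differentiable (by simp) _).hasDerivAt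
    (hζ.differentiable (by simp) _).hasDerivAt
    (Real.hasDerivAt_cos (u 1)) (Real.hasDerivAt_sin (u 1))).1

/-- Two parametrizations of a surface have the same tangent plane at a common point. -/
lemma exists_fderiv_eq_fderiv {X : M → E3} {Y Y' : E2 → E3} {p : M}
    {σ σ' : OpenPartialHomeomorph M E2} (hσ : σ ∈ IsManifold.maximalAtlas (𝓡 2) ∞ M)
    (hσ' : σ' ∈ IsManifold.maximalAtlas (𝓡 2) ∞ M) (hp : p ∈ σ.source) (hp' : p ∈ σ'.source)
    (hX : ∀ q ∈ σ.source, X q = Y (σ q)) (hX' : ∀ q ∈ σ'.source, X q = Y' (σ' q))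
    (hY : DifferentiableAt ℝ Y (σ p)) (v : E2) :
    ∃ w, fderiv ℝ Y' (σ' p) v = fderiv ℝ Y (σ p) w := by
  have hsymm : σ'.symm (σ' p) = p := σ'.left_inv hp'
  have ht : DifferentiableAt ℝ (fun u => σ (σ'.symm u)) (σ' p) := by
    have h1 := contMDiffAt_symm_of_mem_maximalAtlas hσ' (σ'.map_source hp')
    have h2 : ContMDiffAt (𝓡 2) (𝓡 2) ∞ σ (σ'.symm (σ' p)) := by
      rw [hsymm]
      exact contMDiffAt_of_mem_maximalAtlas hσ hp
    exact (contMDiffAt_iff_contDiffAt.1 (h2.comp _ h1)).differentiableAt (by simp)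
  have heq : Y' =ᶠ[𝓝 (σ' p)] fun u => Y (σ (σ'.symm u)) := by
    have h1 : ∀ᶠ u in 𝓝 (σ' p), σ'.symm u ∈ σ.source :=
      (σ'.continuousAt_symm (σ'.map_source hp')).eventually
        (by rw [hsymm]; exact σ.open_source.mem_nhds hp)
    filter_upwards [h1, σ'.open_target.mem_nhds (σ'.map_source hp')] with u hu hu'
    rw [← hX _ hu, hX' _ (σ'.map_target hu'), σ'.right_inv hu']
  have hY' : HasFDerivAt Y (fderiv ℝ Y (σ p)) (σ (σ'.symm (σ' p))) := by
    rw [hsymm]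
    exact hY.hasFDerivAt
  have h2 := (hY'.comp (σ' p) ht.hasFDerivAt).congr_of_eventuallyEq heq
  rw [h2.fderiv]
  exact ⟨_, rfl⟩

/-- The constants of the explicit family are determined by the surface near any point: the unit
normal with positive support function determines `(u₁, u₂)`, and then the support function
`e ^ (a u₁ + b)` and the height determine `a` and `b`. -/
lemma eq_of_isParametrizedNear {X : M → E3} (hX : IsSSSurface X) (A : E3 ≃ₗᵢ[ℝ] E3) {p : M}
    {a b a' b' : ℝ} (h : IsParametrizedNear X (fun u => A (rotationalSS a b u)) p)
    (h' : IsParametrizedNear X (fun u => A (rotationalSS a' b' u)) p) : (a, b) = (a', b') := by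
  obtain ⟨σ, hσ, hp, hXσ⟩ := h
  obtain ⟨σ', hσ', hp', hXσ'⟩ := h'
  have hd : ∀ a b : ℝ, ∀ u v, fderiv ℝ (fun u => A (rotationalSS a b u)) u v =
      A (fderiv ℝ (rotationalSS a b) u v) := fun a b u v => by
    have := A.comp_fderiv (f := rotationalSS a b) (x := u)
    change fderiv ℝ (A ∘ rotationalSS a b) u v = _
    rw [this]
    rfl
  have hdiff : DifferentiableAt ℝ (fun u => A (rotationalSS a b u)) (σ p) :=
    A.differentiable.differentiableAt.comp (σ p)
      (differentiable_revolve (contDiff_profileM a b) (contDiff_profileN a b) _)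
  have hn' : ∀ v, inner ℝ (A (familyNormal (σ' p)))
      (fderiv ℝ (fun u => A (rotationalSS a' b' u)) (σ' p) v) = 0 := fun v => by
    rw [hd, A.inner_map_map, inner_familyNormal_fderiv]
  have hn : ∀ v, inner ℝ (A (familyNormal (σ p)))
      (fderiv ℝ (fun u => A (rotationalSS a' b' u)) (σ' p) v) = 0 := fun v => by
    obtain ⟨w, hw⟩ := exists_fderiv_eq_fderiv (Y := fun u => A (rotationalSS a b u))
      (Y' := fun u => A (rotationalSS a' b' u)) hσ hσ' hp hp' hXσ hXσ' hdiff v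
    rw [hw, hd, A.inner_map_map, inner_familyNormal_fderiv]
  have hc := (hX.isSSAt (Y := fun u => A (rotationalSS a' b' u)) hσ' hXσ'
    (σ'.map_source hp')).cross_ne_zero
  obtain ⟨k, hk⟩ := exists_smul_cross hc (hn _) (hn _)
  obtain ⟨k', hk'⟩ := exists_smul_cross hc (hn' _) (hn' _)
  have hXX : A (rotationalSS a b (σ p)) = A (rotationalSS a' b' (σ' p)) :=
    (hXσ p hp).symm.trans (hXσ' p hp')
  have hψ : inner ℝ (X p) (A (familyNormal (σ p))) = Real.exp (a * σ p 0 + b) := by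
    rw [hXσ p hp, A.inner_map_map, inner_rotationalSS_familyNormal]
  have hψ' : inner ℝ (X p) (A (familyNormal (σ' p))) = Real.exp (a' * σ' p 0 + b') := by
    rw [hXσ' p hp', A.inner_map_map, inner_rotationalSS_familyNormal]
  have hNN : A (familyNormal (σ p)) = A (familyNormal (σ' p)) := by
    set w := cross (partialD 0 (fun u => A (rotationalSS a' b' u)) (σ' p))
      (partialD 1 (fun u => A (rotationalSS a' b' u)) (σ' p))
    have e1 : inner ℝ (A (familyNormal (σ p))) (A (familyNormal (σ p))) = 1 := by
      rw [A.inner_map_map, inner_familyNormal_self]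
    have e2 : inner ℝ (A (familyNormal (σ' p))) (A (familyNormal (σ' p))) = 1 := by
      rw [A.inner_map_map, inner_familyNormal_self]
    have p1 := Real.exp_pos (a * σ p 0 + b)
    have p2 := Real.exp_pos (a' * σ' p 0 + b')
    rw [← hψ, hk, real_inner_smul_right] at p1
    rw [← hψ', hk', real_inner_smul_right] at p2
    rw [hk, real_inner_smul_left, real_inner_smul_right] at e1
    rw [hk', real_inner_smul_left, real_inner_smul_right] at e2
    have hkk : (k - k') * (k + k') = 0 := by
      linear_combination k' ^ 2 * e1 - k ^ 2 * e2
    rcases mul_eq_zero.1 hkk with h0 | h0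
    · rw [hk, hk', sub_eq_zero.1 h0]
    · rw [eq_neg_of_add_eq_zero_left h0] at p1
      linarith
  have hfam := A.injective hNN
  have h2 := congrArg (· 2) hfam
  simp only [familyNormal, spin, Matrix.cons_val, neg_inj, ← Real.tanh_eq_sinh_div_cosh] at h2
  have hu : σ p 0 = σ' p 0 := Real.tanh_injective h2
  have hexp : Real.exp (a * σ p 0 + b) = Real.exp (a' * σ' p 0 + b') := by
    rw [← hψ, ← hψ', hNN]
  have h3 := congrArg (· 2) (A.injective hXX)
  simp only [rotationalSS, revolve, Matrix.cons_val, profileN_eq] at h3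
  rw [hexp, hu] at h3
  have ha : a = a' := by
    have := mul_left_cancel₀ (Real.exp_pos _).ne' h3
    linarith
  have hb := Real.exp_injective hexp
  rw [hu, ha] at hb
  rw [ha, add_left_cancel hb]

/-! ### The axis -/

/-- If a quadratic polynomial with non-zero leading coefficient vanishes at the values of
`c₁ cos t + c₂ sin t` for `t` near `t₀`, then `c₁ = c₂ = 0`. -/
lemma eq_zero_of_quadratic_cos_sin {α β γ c₁ c₂ t₀ : ℝ} (hγ : γ ≠ 0)
    (h : ∀ᶠ t in 𝓝 t₀, α + β * (c₁ * Real.cos t + c₂ * Real.sin t)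
      + γ * (c₁ * Real.cos t + c₂ * Real.sin t) ^ 2 = 0) : c₁ = 0 ∧ c₂ = 0 := by
  set k : ℝ → ℝ := fun t => c₁ * Real.cos t + c₂ * Real.sin t with hk
  set l : ℝ → ℝ := fun t => -(c₁ * Real.sin t) + c₂ * Real.cos t with hl
  have dk : ∀ t, HasDerivAt k (l t) t := fun t =>
    (((Real.hasDerivAt_cos t).const_mul c₁).fun_add
      ((Real.hasDerivAt_sin t).const_mul c₂)).congr_deriv (by rw [hl]; ring)
  have dl : ∀ t, HasDerivAt l (-k t) t := fun t =>
    ((((Real.hasDerivAt_sin t).const_mul c₁).fun_neg).fun_add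
      ((Real.hasDerivAt_cos t).const_mul c₂)).congr_deriv (by rw [hk]; ring)
  have deriv_zero : ∀ {f : ℝ → ℝ} {f' : ℝ → ℝ}, (∀ t, HasDerivAt f (f' t) t) →
      (∀ᶠ t in 𝓝 t₀, f t = 0) → ∀ᶠ t in 𝓝 t₀, f' t = 0 := by
    intro f f' hf h0
    have h0' : f =ᶠ[𝓝 t₀] fun _ => (0 : ℝ) := h0
    filter_upwards [h0'.deriv] with t ht
    rw [← (hf t).deriv, ht, deriv_const]
  have h1 : ∀ᶠ t in 𝓝 t₀, (β + 2 * γ * k t) * l t = 0 :=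
    deriv_zero (f := fun t => α + β * k t + γ * k t ^ 2) (fun t =>
      ((((dk t).const_mul β).const_add α).fun_add
        (((dk t).fun_pow 2).const_mul γ)).congr_deriv (by norm_num; ring)) h
  have h2 : ∀ᶠ t in 𝓝 t₀, 2 * γ * l t * l t + (β + 2 * γ * k t) * (-k t) = 0 :=
    deriv_zero (fun t => (((dk t).const_mul (2 * γ)).const_add β).fun_mul (dl t)) h1
  have h3 : ∀ᶠ t in 𝓝 t₀, l t = 0 := by
    filter_upwards [h1, h2] with t h1 h2
    have : 2 * γ * l t ^ 3 = 0 := by linear_combination l t * h2 + k t * h1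
    simpa [hγ] using this
  have h4 := (deriv_zero dl h3).self_of_nhds
  have h5 := h3.self_of_nhds
  have hcs := Real.cos_sq_add_sin_sq t₀
  simp only [hk, hl] at h4 h5
  constructor
  · linear_combination -Real.cos t₀ * h4 - Real.sin t₀ * h5 - c₁ * hcs
  · linear_combination -Real.sin t₀ * h4 + Real.cos t₀ * h5 - c₂ * hcs

/-- The axis of an SS-surface of rotation passes through the origin: along a parallel circle the
support function and `Λ` depend on the angle only through the radial component of the translation
`c`, and `ψ²` contributes the only quadratic term to the SS-condition. -/
lemma IsSSSurface.axis_through_origin {X : M → E3} (hX : IsSSSurface X) (A : E3 ≃ₗᵢ[ℝ] E3)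
    (c : E3) {ρ ζ : ℝ → ℝ} (hρ : ContDiff ℝ ∞ ρ) (hζ : ContDiff ℝ ∞ ζ) {p : M}
    (h : IsParametrizedNear X (fun u => A (revolve ρ ζ u + c)) p) : c ∈ x3Axis := by
  obtain ⟨σ, hσ, hp, hXσ⟩ := h
  have hcurve : ∀ᶠ t in 𝓝 (σ p 1), coordLine 1 (σ p) t ∈ σ.target :=
    (continuous_coordLine 1 (σ p)).continuousAt.eventually (by
      rw [coordLine_self]
      exact σ.open_target.mem_nhds (σ.map_source hp))
  have key : ∀ t, coordLine 1 (σ p) t ∈ σ.target → _ := fun t ht =>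
    IsSSAt.revolve_eq hρ hζ A c (u := coordLine 1 (σ p) t)
      (hX.isSSAt (Y := fun u => A (revolve ρ ζ u + c)) hσ hXσ ht) rfl rfl rfl rfl rfl rfl rfl
  simp only [coordLine_apply, if_true, zero_ne_one, if_false] at key
  set r := ρ (σ p 0)
  set r' := deriv ρ (σ p 0)
  set r'' := deriv (deriv ρ) (σ p 0)
  set z := ζ (σ p 0) + c 2
  set z' := deriv ζ (σ p 0)
  set z'' := deriv (deriv ζ) (σ p 0)
  set D := r' * z'' - z' * r''
  obtain ⟨-, hz', hD, -⟩ := key _ hcurve.self_of_nhds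
  refine eq_zero_of_quadratic_cos_sin (t₀ := σ p 1) (γ := D * z' ^ 3)
    (α := (r' ^ 2 + z' ^ 2) * (r' * z - z' * r) * (D * r + z' * (r' ^ 2 + z' ^ 2)) +
      ((r' ^ 2 + z' ^ 2) * (r ^ 2 + c 0 ^ 2 + c 1 ^ 2 + z ^ 2) + (r' * z - z' * r) ^ 2) *
        (D * z'))
    (β := -(r' ^ 2 + z' ^ 2) * z' * (D * r + z' * (r' ^ 2 + z' ^ 2)) +
      ((r' ^ 2 + z' ^ 2) * (2 * r) - 2 * (r' * z - z' * r) * z') * (D * z'))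
    (mul_ne_zero hD (pow_ne_zero 3 hz')) ?_
  filter_upwards [hcurve] with t ht
  linear_combination (key t ht).2.2.2

lemma contDiffOn_symm_comp {X : M → E3} (hX : IsSSSurface X) (A : E3 ≃ₗᵢ[ℝ] E3)
    {σ : OpenPartialHomeomorph M E2} (hσ : σ ∈ IsManifold.maximalAtlas (𝓡 2) ∞ M) :
    ContDiffOn ℝ ∞ (fun u => A.symm (X (σ.symm u))) σ.target := by
  have h1 := hX.1.1.comp_contMDiffOn (contMDiffOn_symm_of_mem_maximalAtlas hσ)
  exact A.symm.contDiff.comp_contDiffOn (contMDiffOn_iff_contDiffOn.1 h1)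

lemma cross_symm_comp_ne_zero {X : M → E3} (hX : IsSSSurface X) (A : E3 ≃ₗᵢ[ℝ] E3)
    {σ : OpenPartialHomeomorph M E2} (hσ : σ ∈ IsManifold.maximalAtlas (𝓡 2) ∞ M) {u : E2}
    (hu : u ∈ σ.target) :
    cross (partialD 0 (fun u => A.symm (X (σ.symm u))) u)
      (partialD 1 (fun u => A.symm (X (σ.symm u))) u) ≠ 0 := by
  have h := (hX.2 σ hσ u hu).cross_ne_zero
  have e := partialD_isometry_comp A.symm 0 (fun u => X (σ.symm u))
  simp only [add_zero] at e
  rwa [e, e, Ne, cross_isometry_eq_zero_iff]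

/-- No open piece of the surface lies on a line: there the tangent vectors would be parallel. -/
lemma frequently_notMem_axis [IsManifold (𝓡 2) ∞ M] {X : M → E3} (hX : IsSSSurface X)
    (A : E3 ≃ₗᵢ[ℝ] E3) (c : E3) (p : M) :
    ∃ᶠ q in 𝓝 p, X q ∉ (fun x => A (x + c)) '' x3Axis := by
  intro hcon
  have hσ := IsManifold.chart_mem_maximalAtlas (I := 𝓡 2) (n := ∞) p
  set σ := chartAt E2 p
  have hp : p ∈ σ.source := mem_chart_source E2 p
  have hu := σ.map_source hp
  set Z : E2 → E3 := fun u => A.symm (X (σ.symm u)) with hZ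
  have hd : DifferentiableAt ℝ Z (σ p) :=
    ((contDiffOn_symm_comp hX A hσ).contDiffAt (σ.open_target.mem_nhds hu)).differentiableAt
      (by simp)
  have hev : ∀ᶠ u in 𝓝 (σ p), Z u 0 = c 0 ∧ Z u 1 = c 1 := by
    have h1 : Filter.Tendsto σ.symm (𝓝 (σ p)) (𝓝 p) := σ.tendsto_symm hp
    filter_upwards [h1.eventually hcon] with u hu
    obtain ⟨x, hx, hxu⟩ := not_not.1 hu
    simp only [hZ, ← hxu, A.symm_apply_apply, PiLp.add_apply, hx.1, hx.2, zero_add, and_self]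
  have h0 : ∀ i, partialD i Z (σ p) 0 = 0 := fun i => by
    have : (fun u => Z u 0) =ᶠ[𝓝 (σ p)] fun _ => c 0 := hev.mono fun u hu => hu.1
    rw [partialD, fderiv_apply_coord hd, this.fderiv_eq]
    simp
  have h1 : ∀ i, partialD i Z (σ p) 1 = 0 := fun i => by
    have : (fun u => Z u 1) =ᶠ[𝓝 (σ p)] fun _ => c 1 := hev.mono fun u hu => hu.2
    rw [partialD, fderiv_apply_coord hd, this.fderiv_eq]
    simp
  apply cross_symm_comp_ne_zero hX A hσ hu
  apply ext_three <;> simp only [cross_zero, cross_one, cross_two, ← hZ, h0, h1] <;> simp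

lemma fderiv_eq_partialD (Z : E2 → E3) (u v : E2) :
    fderiv ℝ Z u v = v 0 • partialD 0 Z u + v 1 • partialD 1 Z u := by
  have : v = v 0 • EuclideanSpace.single 0 (1 : ℝ) + v 1 • EuclideanSpace.single 1 (1 : ℝ) := by
    ext i
    fin_cases i <;> simp
  conv_lhs => rw [this, map_add, map_smul, map_smul]
  rfl

/-- The points of a surface of rotation on the axis are isolated: everywhere the rotational vector
field `(-x₂, x₁, 0)` is tangent to the surface; differentiating this condition at a point of the
axis shows that the normal is parallel to the axis there. -/
lemma eventually_notMem_axis [IsManifold (𝓡 2) ∞ M] {X : M → E3} (hX : IsSSSurface X)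
    (A : E3 ≃ₗᵢ[ℝ] E3)
    (hrot : ∀ p : M, X p ∉ A '' x3Axis → ∃ ρ ζ : ℝ → ℝ, ContDiff ℝ ∞ ρ ∧ ContDiff ℝ ∞ ζ ∧
      IsParametrizedNear X (fun u => A (revolve ρ ζ u)) p)
    {σ : OpenPartialHomeomorph M E2} (hσ : σ ∈ IsManifold.maximalAtlas (𝓡 2) ∞ M) {p : M}
    (hp : p ∈ σ.source) (hpa : X p ∈ A '' x3Axis) :
    ∀ᶠ u in 𝓝[≠] (σ p), X (σ.symm u) ∉ A '' x3Axis := by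
  have hu := σ.map_source hp
  set Z : E2 → E3 := fun u => A.symm (X (σ.symm u)) with hZ
  have hZs := contDiffOn_symm_comp hX A hσ
  have hd : ∀ u ∈ σ.target, DifferentiableAt ℝ Z u := fun u hu =>
    (hZs.contDiffAt (σ.open_target.mem_nhds hu)).differentiableAt (by simp)
  have haxis : ∀ u, X (σ.symm u) ∈ A '' x3Axis ↔ Z u ∈ x3Axis := fun u => by
    constructor
    · rintro ⟨x, hx, hxu⟩
      simpa [hZ, ← hxu] using hx
    · exact fun h => ⟨_, h, by simp [hZ]⟩
  have hpZ : Z (σ p) ∈ x3Axis := by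
    rw [← haxis, σ.left_inv hp]
    exact hpa
  set ν : E2 → E3 := fun u => cross (partialD 0 Z u) (partialD 1 Z u) with hν
  -- on the axis both coordinates vanish; off the axis `(-x₂, x₁, 0)` is the derivative in the
  -- direction of the angle, hence tangent
  have hFzero : ∀ u ∈ σ.target, ν u 1 * Z u 0 - ν u 0 * Z u 1 = 0 := by
    intro u hu
    by_cases ha : Z u ∈ x3Axis
    · rw [ha.1, ha.2]; ring
    · rw [← haxis] at ha
      obtain ⟨ρ, ζ, hρ, hζ, σ', hσ', hq, hXσ'⟩ := hrot _ ha
      have hXA : ∀ q ∈ σ'.source, A.symm (X q) = revolve ρ ζ (σ' q) := fun q hq => by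
        rw [hXσ' q hq, A.symm_apply_apply]
      have hus := σ.map_target hu
      obtain ⟨w, hw⟩ := exists_fderiv_eq_fderiv (X := fun q => A.symm (X q)) (Y := Z) hσ hσ' hus hq
        (fun q hq => by simp [hZ, σ.left_inv hq]) hXA
        (by rw [σ.right_inv hu]; exact hd u hu) (EuclideanSpace.single 1 1)
      rw [σ.right_inv hu, show revolve ρ ζ = spin ρ ζ Real.cos Real.sin from rfl,
        (spin_differential (hρ.differentiable (by simp) _).hasDerivAt
          (hζ.differentiable (by simp) _).hasDerivAt (Real.hasDerivAt_cos _)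
          (Real.hasDerivAt_sin _)).2, fderiv_eq_partialD] at hw
      have hZu : Z u = revolve ρ ζ (σ' (σ.symm u)) := hXA _ hq
      have h3 : inner ℝ (ν u) (w 0 • partialD 0 Z u + w 1 • partialD 1 Z u) = 0 := by
        rw [inner_add_right, real_inner_smul_right, real_inner_smul_right, hν, inner_cross_left,
          inner_cross_right]
        ring
      rw [← hw, inner_eq_sum] at h3
      simp at h3
      rw [hZu]
      simp only [revolve, Matrix.cons_val_zero, Matrix.cons_val_one]
      linear_combination h3
  have hnu0 : ν (σ p) ≠ 0 := cross_symm_comp_ne_zero hX A hσ hu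
  have hνd : DifferentiableAt ℝ ν (σ p) := by
    have hfd : DifferentiableAt ℝ (fderiv ℝ Z) (σ p) :=
      ((hZs.contDiffAt (σ.open_target.mem_nhds hu)).fderiv_right (m := 1)
        (by norm_cast)).differentiableAt (by simp)
    have hpd : ∀ i (j : Fin 3), DifferentiableAt ℝ (fun u => partialD i Z u j) (σ p) := by
      intro i
      rw [← differentiableAt_euclidean]
      exact hfd.clm_apply (differentiableAt_const _)
    rw [differentiableAt_euclidean]
    intro i
    fin_cases i
    · change DifferentiableAt ℝ (fun u => cross (partialD 0 Z u) (partialD 1 Z u) 0) _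
      simp only [cross_zero]
      exact ((hpd 0 1).mul (hpd 1 2)).sub ((hpd 0 2).mul (hpd 1 1))
    · change DifferentiableAt ℝ (fun u => cross (partialD 0 Z u) (partialD 1 Z u) 1) _
      simp only [cross_one]
      exact ((hpd 0 2).mul (hpd 1 0)).sub ((hpd 0 0).mul (hpd 1 2))
    · change DifferentiableAt ℝ (fun u => cross (partialD 0 Z u) (partialD 1 Z u) 2) _
      simp only [cross_two]
      exact ((hpd 0 0).mul (hpd 1 1)).sub ((hpd 0 1).mul (hpd 1 0))
  have hνi := differentiableAt_euclidean.1 hνd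
  have hZi := differentiableAt_euclidean.1 (hd _ hu)
  have hderiv : ∀ i, ν (σ p) 1 * partialD i Z (σ p) 0 - ν (σ p) 0 * partialD i Z (σ p) 1 = 0 := by
    intro i
    have h1 := ((hνi 1).hasFDerivAt.mul (hZi 0).hasFDerivAt).sub
      ((hνi 0).hasFDerivAt.mul (hZi 1).hasFDerivAt)
    have h2 : HasFDerivAt (fun _ : E2 => (0 : ℝ)) _ (σ p) :=
      h1.congr_of_eventuallyEq (by
        filter_upwards [σ.open_target.mem_nhds hu] with u hu
        exact (hFzero u hu).symm)
    have h3 := congrArg (· (EuclideanSpace.single i 1)) (h2.unique (hasFDerivAt_const 0 (σ p)))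
    simp only [partialD, fderiv_apply_coord (hd _ hu)]
    simpa [hpZ.1, hpZ.2] using h3
  -- `(ν₂, -ν₁, 0)` is orthogonal to the surface, hence a multiple of `ν`, to which it is orthogonal
  obtain ⟨hν0, hν1⟩ : ν (σ p) 0 = 0 ∧ ν (σ p) 1 = 0 := by
    obtain ⟨k, hk⟩ := exists_smul_cross (ν := !₂[ν (σ p) 1, -ν (σ p) 0, 0]) hnu0
      (by rw [inner_eq_sum]; simp; linear_combination hderiv 0)
      (by rw [inner_eq_sum]; simp; linear_combination hderiv 1)
    have e0 := congrArg (· 0) hk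
    have e1 := congrArg (· 1) hk
    change ν (σ p) 1 = k * ν (σ p) 0 at e0
    change -ν (σ p) 0 = k * ν (σ p) 1 at e1
    have h0 : ν (σ p) 0 = 0 := by
      have : (1 + k ^ 2) * ν (σ p) 0 = 0 := by linear_combination -e1 - k * e0
      exact (mul_eq_zero.1 this).resolve_left (by positivity)
    exact ⟨h0, by rw [e0, h0, mul_zero]⟩
  have hν2 : ν (σ p) 2 ≠ 0 := fun h2 => hnu0 (ext_three hν0 hν1 h2)
  -- hence the projection along the axis is a local diffeomorphism near the point
  let π : E3 →L[ℝ] E2 := LinearMap.toContinuousLinearMap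
    { toFun := fun x => !₂[x 0, x 1]
      map_add' := fun x y => by ext i; fin_cases i <;> simp
      map_smul' := fun c x => by ext i; fin_cases i <;> simp }
  have hπ : HasFDerivAt (fun u => π (Z u)) (π.comp (fderiv ℝ Z (σ p))) (σ p) :=
    π.hasFDerivAt.comp (σ p) (hd _ hu).hasFDerivAt
  have hker : (π.comp (fderiv ℝ Z (σ p)) : E2 →ₗ[ℝ] E2).ker = ⊥ := by
    rw [LinearMap.ker_eq_bot']
    intro v hv
    change π (fderiv ℝ Z (σ p) v) = 0 at hv
    rw [fderiv_eq_partialD] at hv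
    have e0 := congrArg (· 0) hv
    have e1 := congrArg (· 1) hv
    simp [π] at e0 e1
    simp only [hν, cross_two] at hν2
    ext i
    fin_cases i
    · refine (mul_eq_zero.1 (?_ : _ * v 0 = 0)).resolve_left hν2
      linear_combination partialD 1 Z (σ p) 1 * e0 - partialD 1 Z (σ p) 0 * e1
    · refine (mul_eq_zero.1 (?_ : _ * v 1 = 0)).resolve_left hν2
      linear_combination partialD 0 Z (σ p) 0 * e1 - partialD 0 Z (σ p) 1 * e0
  obtain ⟨K, -, hK⟩ := LinearMap.exists_antilipschitzWith _ hker
  filter_upwards [hπ.eventually_ne (c := 0) ⟨K, hK⟩] with u hu h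
  rw [haxis] at h
  apply hu
  ext i
  fin_cases i
  · exact h.1
  · exact h.2

/-! ### Global constancy of the parameters -/

/-- A non-empty preconnected set covered by disjoint open sets lies in one of them. -/
lemma exists_subset_of_isPreconnected {α ι : Type*} [TopologicalSpace α] {s : Set α}
    (hs : IsPreconnected s) (hne : s.Nonempty) {U : ι → Set α} (hU : ∀ i, IsOpen (U i))
    (hd : ∀ i j, (U i ∩ U j).Nonempty → i = j) (hcov : ∀ x ∈ s, ∃ i, x ∈ U i) :
    ∃ i, s ⊆ U i := by
  obtain ⟨x, hx⟩ := hne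
  obtain ⟨i, hi⟩ := hcov x hx
  refine ⟨i, hs.subset_left_of_subset_union (v := ⋃ j ∈ {j | j ≠ i}, U j) (hU i)
    (isOpen_biUnion fun j _ => hU j) ?_ ?_ ⟨x, hx, hi⟩⟩
  · rw [Set.disjoint_iUnion₂_right]
    intro j hj
    rw [Set.disjoint_iff_inter_eq_empty, ← Set.not_nonempty_iff_eq_empty]
    exact fun h => hj (hd i j h).symm
  · intro y hy
    obtain ⟨j, hj⟩ := hcov y hy
    by_cases h : j = i
    · exact Or.inl (h ▸ hj)
    · exact Or.inr (Set.mem_biUnion h hj)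

lemma isConnected_ball_diff_center (u : E2) {r : ℝ} (hr : 0 < r) :
    IsConnected (Metric.ball u r \ {u}) := by
  have h : Metric.ball u r \ {u} = OpenPartialHomeomorph.univBall u r '' {0}ᶜ := by
    have hsrc := OpenPartialHomeomorph.univBall_source u r
    have hinj : Set.InjOn (OpenPartialHomeomorph.univBall u r) Set.univ :=
      hsrc ▸ (OpenPartialHomeomorph.univBall u r).injOn
    rw [Set.compl_eq_univ_sdiff, hinj.image_sdiff, Set.univ_inter, Set.image_singleton,
      OpenPartialHomeomorph.univBall_apply_zero, ← hsrc,
      OpenPartialHomeomorph.image_source_eq_target, OpenPartialHomeomorph.univBall_target u hr]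
  rw [h]
  refine (isConnected_compl_singleton_of_one_lt_rank ?_ 0).image _
    (OpenPartialHomeomorph.continuous_univBall u r).continuousOn
  rw [← Module.finrank_eq_rank, finrank_euclideanSpace_fin]
  norm_num

lemma IsParametrizedNear.eventually {X : M → E3} {Y : E2 → E3} {p : M}
    (h : IsParametrizedNear X Y p) : ∀ᶠ q in 𝓝 p, IsParametrizedNear X Y q := by
  obtain ⟨σ, hσ, hp, hX⟩ := h
  filter_upwards [σ.open_source.mem_nhds hp] with q hq
  exact ⟨σ, hσ, hq, hX⟩

/-- The constants of the explicit family are the same at all points off the axis. Near a point of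
the axis they do not change since the points of the axis are isolated and a punctured disc is
connected. -/
lemma exists_rotationalSS [IsManifold (𝓡 2) ∞ M] [ConnectedSpace M] {X : M → E3}
    (hX : IsSSSurface X) (A : E3 ≃ₗᵢ[ℝ] E3)
    (hrot : ∀ p : M, X p ∉ A '' x3Axis → ∃ ρ ζ : ℝ → ℝ, ContDiff ℝ ∞ ρ ∧ ContDiff ℝ ∞ ζ ∧
      IsParametrizedNear X (fun u => A (revolve ρ ζ u)) p) :
    ∃ a b : ℝ, ∀ p : M, X p ∉ A '' x3Axis →
      IsParametrizedNear X (fun u => A (rotationalSS a b u)) p := by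
  set U : ℝ × ℝ → Set M := fun i => {p | ∀ᶠ q in 𝓝 p, X q ∉ A '' x3Axis →
    IsParametrizedNear X (fun u => A (rotationalSS i.1 i.2 u)) q} with hUdef
  have hU : ∀ i, IsOpen (U i) := fun i => isOpen_setOfPred_eventually_nhds
  have hdisj : ∀ i j, (U i ∩ U j).Nonempty → i = j := by
    rintro i j ⟨p, hi, hj⟩
    have hfreq := frequently_notMem_axis hX A 0 p
    simp only [add_zero] at hfreq
    obtain ⟨q, hq, hqi, hqj⟩ := (hfreq.and_eventually (hi.and hj)).exists
    exact eq_of_isParametrizedNear hX A (hqi hq) (hqj hq)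
  have hoff : ∀ p, X p ∉ A '' x3Axis → ∃ i, p ∈ U i := by
    intro p hp
    obtain ⟨ρ, ζ, hρ, hζ, h⟩ := hrot p hp
    obtain ⟨a, b, hab⟩ := exists_isParametrizedNear_rotationalSS hX A hρ hζ h
    exact ⟨(a, b), hab.eventually.mono fun q hq _ => hq⟩
  have hcov : ∀ p, ∃ i, p ∈ U i := by
    intro p
    by_cases hpa : X p ∈ A '' x3Axis
    swap
    · exact hoff p hpa
    have hσ := IsManifold.chart_mem_maximalAtlas (I := 𝓡 2) (n := ∞) p
    set σ := chartAt E2 p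
    have hp : p ∈ σ.source := mem_chart_source E2 p
    have hiso := eventually_notMem_axis hX A hrot hσ hp hpa
    rw [eventually_nhdsWithin_iff] at hiso
    obtain ⟨r, hr, hball⟩ := Metric.eventually_nhds_iff_ball.1
      (hiso.and (σ.open_target.mem_nhds (σ.map_source hp)))
    have hconn := (isConnected_ball_diff_center (σ p) hr).image σ.symm
      (σ.continuousOn_symm.mono fun u hu => (hball u hu.1).2)
    obtain ⟨i, hi⟩ := exists_subset_of_isPreconnected hconn.isPreconnected hconn.nonempty hU hdisj
      (by
        rintro _ ⟨u, hu, rfl⟩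
        exact hoff _ ((hball u hu.1).1 hu.2))
    refine ⟨i, ?_⟩
    filter_upwards [σ.open_source.mem_nhds hp,
      (σ.continuousAt hp).eventually (Metric.ball_mem_nhds (σ p) hr)] with q hq hqb hqa
    have hne : σ q ≠ σ p := fun h => hqa (σ.injOn hq hp h ▸ hpa)
    exact (hi ⟨σ q, ⟨hqb, hne⟩, σ.left_inv hq⟩).self_of_nhds hqa
  obtain ⟨i, hi⟩ := exists_subset_of_isPreconnected (isPreconnected_univ (α := M))
    Set.univ_nonempty hU hdisj fun p _ => hcov p
  exact ⟨i.1, i.2, fun p hp => (hi (Set.mem_univ p)).self_of_nhds hp⟩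

/-- Every isometry of space is a translation followed by an orthogonal transformation. -/
lemma exists_isometry_eq (Φ : E3 ≃ᵃⁱ[ℝ] E3) :
    ∃ (A : E3 ≃ₗᵢ[ℝ] E3) (c : E3), ∀ x, Φ x = A (x + c) := by
  refine ⟨Φ.linearIsometryEquiv, Φ.linearIsometryEquiv.symm (Φ 0), fun x => ?_⟩
  have h := Φ.map_vadd 0 x
  simp only [vadd_eq_add, add_zero] at h
  rw [map_add, LinearIsometryEquiv.apply_symm_apply, h]

/-- An SS-surface of rotation is, up to an orthogonal transformation, parametrized by the explicit
family off its axis. -/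
lemma IsSurfaceOfRotation.exists_rotationalSS [IsManifold (𝓡 2) ∞ M] [ConnectedSpace M]
    {X : M → E3} (hX : IsSSSurface X) (h : IsSurfaceOfRotation X) :
    ∃ (A : E3 ≃ₗᵢ[ℝ] E3) (a b : ℝ), ∀ p : M, X p ∉ A '' x3Axis →
      IsParametrizedNear X (fun u => A (rotationalSS a b u)) p := by
  obtain ⟨Φ, hΦ⟩ := h
  obtain ⟨A, c, hA⟩ := exists_isometry_eq Φ
  have hfun : (Φ : E3 → E3) = fun x => A (x + c) := funext hA
  rw [IsSurfaceOfRotationAbout, hfun] at hΦ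
  obtain ⟨p₀⟩ := (inferInstance : Nonempty M)
  obtain ⟨p₁, hp₁⟩ := (frequently_notMem_axis hX A c p₀).exists
  obtain ⟨ρ₁, ζ₁, hρ₁, hζ₁, h₁⟩ := hΦ p₁ hp₁
  have hc : c ∈ x3Axis := hX.axis_through_origin A c hρ₁ hζ₁ h₁
  have haxis : (fun x => A (x + c)) '' x3Axis = A '' x3Axis := by
    ext y
    constructor
    · rintro ⟨x, hx, rfl⟩
      exact ⟨x + c, ⟨by simp [hx.1, hc.1], by simp [hx.2, hc.2]⟩, rfl⟩
    · rintro ⟨x, hx, rfl⟩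
      exact ⟨x - c, ⟨by simp [hx.1, hc.1], by simp [hx.2, hc.2]⟩, by simp⟩
  rw [haxis] at hΦ
  refine ⟨A, SSSurface.exists_rotationalSS hX A fun p hp => ?_⟩
  obtain ⟨ρ, ζ, hρ, hζ, h⟩ := hΦ p hp
  refine ⟨ρ, fun t => ζ t + c 2, hρ, hζ.add contDiff_const, ?_⟩
  convert h using 3 with u
  apply ext_three <;> simp [revolve, hc.1, hc.2]

end SSSurface

theorem mainTheorem3 {M : Type*} [TopologicalSpace M] [ChartedSpace SSSurface.E2 M]
    [IsManifold (𝓡 2) ∞ M] [ConnectedSpace M] (X : M → SSSurface.E3)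
    (hX : SSSurface.IsSSSurface X) :
    -- arbitrary axis: up to an orthogonal transformation of space
    (SSSurface.IsSurfaceOfRotation X ↔
      ∃ (A : SSSurface.E3 ≃ₗᵢ[ℝ] SSSurface.E3) (a b : ℝ),
        ∀ p : M, X p ∉ A '' SSSurface.x3Axis →
          SSSurface.IsParametrizedNear X (fun u => A (SSSurface.rotationalSS a b u)) p) ∧
    -- axis equal to the third coordinate axis
    (SSSurface.IsSurfaceOfRotationAbout (AffineIsometryEquiv.refl ℝ SSSurface.E3) X ↔
      ∃ a b : ℝ, ∀ p : M, X p ∉ SSSurface.x3Axis →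
        SSSurface.IsParametrizedNear X (SSSurface.rotationalSS a b) p) ∧
    -- the holomorphic data of the family, and its Gauss map
    (∀ (a : ℝ) (z₀ : ℂ) (u : SSSurface.E2),
      SSSurface.weierSurface (fun z => a * z + z₀) Complex.exp
          ((u 0 : ℂ) + (u 1 : ℂ) * Complex.I)
        = SSSurface.rotationalSS a z₀.re u ∧
      ∀ v : SSSurface.E2,
        inner ℝ (SSSurface.weierNormal Complex.exp ((u 0 : ℂ) + (u 1 : ℂ) * Complex.I))
          (fderiv ℝ (SSSurface.rotationalSS a z₀.re) u v) = 0) := by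
  open SSSurface in
  refine ⟨⟨fun h => h.exists_rotationalSS hX, ?_⟩, ⟨fun h => ?_, ?_⟩, fun a z₀ u =>
    ⟨weierSurface_exp a z₀ u, fun v => ?_⟩⟩
  · rintro ⟨A, a, b, h⟩
    exact ⟨A.toAffineIsometryEquiv, fun p hp => ⟨_, _, contDiff_profileM a b,
      contDiff_profileN a b, h p hp⟩⟩
  · have hid : (AffineIsometryEquiv.refl ℝ E3 : E3 → E3) = LinearIsometryEquiv.refl ℝ E3 := rfl
    rw [IsSurfaceOfRotationAbout, hid] at h
    obtain ⟨a, b, hab⟩ := SSSurface.exists_rotationalSS hX (LinearIsometryEquiv.refl ℝ E3) h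
    refine ⟨a, b, fun p hp => hab p ?_⟩
    rwa [LinearIsometryEquiv.coe_refl, Set.image_id]
  · rintro ⟨a, b, h⟩ p hp
    refine ⟨_, _, contDiff_profileM a b, contDiff_profileN a b, h p ?_⟩
    rwa [AffineIsometryEquiv.coe_refl, Set.image_id] at hp
  · rw [weierNormal_exp, inner_familyNormal_fderiv]
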